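/- Let $d\ge 1$ and $n\ge 0$ be integers, and let $A=\mathbb{C}[u^{\pm1},v]$ with $u,v$ indeterminates. Let $\mathcal H_n$ be the Iwahori--Hecke algebra of type $A_{n-1}$: the associative unital $A$-algebra with generators $T_1,\dots,T_{n-1}$ and relations $T_iT_j=T_jT_i$ for $|i-j|>1$, $T_iT_{i+1}T_i=T_{i+1}T_iT_{i+1}$ for $1\le i\le n-2$, and $T_i^2=u^2+vT_i$ (so $\mathcal H_0=\mathcal H_1=A$). Let $Y_{d,n}$ be the Yokonuma--Hecke algebra: the associative unital $A$-algebra with generators $g_1,\dots,g_{n-1},t_1,\dots,t_n$ and relations $g_ig_j=g_jg_i$ for $|i-j|>1$, $g_ig_{i+1}g_i=g_{i+1}g_ig_{i+1}$ for $1\le i\le n-2$, $t_it_j=t_jt_i$, $g_it_j=t_{s_i(j)}g_i$ with $s_i=(i,i+1)$, $t_j^d=1$, and $g_i^2=u^2+v\,e_ig_i$, where $e_i=\frac1d\sum_{0\le s\le d-1}t_i^s\,t_{i+1}^{-s}$. Let $\operatorname{Comp}_d(n)$ be the set of $d$-tuples $\mu=(\mu_1,\dots,\mu_d)$ of non-negative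 integers with $\mu_1+\dots+\mu_d=n$. For $\mu\in\operatorname{Comp}_d(n)$ let $\mathcal H^\mu$ be the $A$-subalgebra of $\mathcal H_n$ generated by the $T_i$ with $i\in\{1,\dots,n-1\}\setminus\{\mu_1,\mu_1+\mu_2,\dots,\mu_1+\dots+\mu_{d-1}\}$. For a commutative ring $R$, a ring homomorphism (specialization) $\theta:A\to R$ and an $A$-algebra $\mathcal B$, write $R_\theta\mathcal B=R\otimes_A\mathcal B$ for the specialized $R$-algebra, the tensor product being defined via $\theta$. **Proposition 4.2.** For every commutative ring $R$ and every specialization $\theta:\mathbb{C}[u^{\pm1},v]\to R$, the $R$-algebra $R_\theta Y_{d,n}$ is Morita equivalent to $\bigoplus_{\mu\in\operatorname{Comp}_d(n)}R_\theta\mathcal H^\mu$; that is, the categories of modules over these two $R$-algebras are equivalent as $R$-linear categories. -/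

import Mathlib

open scoped TensorProduct

namespace YokonumaHecke

noncomputable section

/-- The ring `ℂ[u^{±1}, v]`: polynomials in `v` over the Laurent polynomials in `u`. -/
def BaseRing : Type := Polynomial (LaurentPolynomial ℂ)

instance : CommRing BaseRing :=
  (Polynomial.commRing : CommRing (Polynomial (LaurentPolynomial ℂ)))

/-- The invertible indeterminate `u`. -/
def u : BaseRing := Polynomial.C (LaurentPolynomial.T 1)

/-- The indeterminate `v`. -/
def v : BaseRing := Polynomial.X

/-- A complex number, seen as a constant of `ℂ[u^{±1}, v]`. -/
def const (z : ℂ) : BaseRing := Polynomial.C (LaurentPolynomial.C z)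

/-! ### The Iwahori--Hecke algebra of type `A_{n-1}`

The generators `T_1, …, T_{n-1}` are indexed by `Fin (n - 1)`, the index `i : Fin (n - 1)`
standing for `i + 1 ∈ {1, …, n-1}`. -/

/-- The generator `T_i` of the free algebra. -/
def freeT {n : ℕ} (i : Fin (n - 1)) : FreeAlgebra BaseRing (Fin (n - 1)) :=
  FreeAlgebra.ι BaseRing i

/-- The defining relations of the Iwahori--Hecke algebra. -/
inductive HeckeRel (n : ℕ) :
    FreeAlgebra BaseRing (Fin (n - 1)) → FreeAlgebra BaseRing (Fin (n - 1)) → Prop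
  | comm (i j : Fin (n - 1)) (hij : 1 < |(i : ℤ) - (j : ℤ)|) :
      HeckeRel n (freeT i * freeT j) (freeT j * freeT i)
  | braid (i j : Fin (n - 1)) (hij : (j : ℕ) = (i : ℕ) + 1) :
      HeckeRel n (freeT i * freeT j * freeT i) (freeT j * freeT i * freeT j)
  | quad (i : Fin (n - 1)) :
      HeckeRel n (freeT i ^ 2) (algebraMap BaseRing _ (u ^ 2) + v • freeT i)

/-- The Iwahori--Hecke algebra `H_n` over `ℂ[u^{±1}, v]` (so `H_0 = H_1 = ℂ[u^{±1}, v]`). -/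
def Hecke (n : ℕ) : Type := RingQuot (HeckeRel n)

instance (n : ℕ) : Ring (Hecke n) := RingQuot.instRing (HeckeRel n)

instance (n : ℕ) : Algebra BaseRing (Hecke n) :=
  RingQuot.instAlgebra (HeckeRel n)

/-- The generator `T_i` of `H_n`. -/
def Hecke.T {n : ℕ} (i : Fin (n - 1)) : Hecke n :=
  RingQuot.mkAlgHom BaseRing (HeckeRel n) (freeT i)

/-! ### Compositions and the subalgebras `H^μ` -/

/-- `Comp_d(n)`: the `d`-tuples of non-negative integers with sum `n`. -/
abbrev Comp (d n : ℕ) : Type := {μ : Fin d → ℕ // ∑ a, μ a = n}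

instance (d n : ℕ) : Finite (Comp d n) := by
  refine Set.Finite.to_subtype (s := {μ : Fin d → ℕ | ∑ a, μ a = n})
    ((Set.finite_Iic (fun _ : Fin d => n)).subset ?_)
  intro μ hμ a
  have hμ' : ∑ a, μ a = n := hμ
  exact hμ' ▸ Finset.single_le_sum (f := μ) (fun _ _ => Nat.zero_le _) (Finset.mem_univ a)

/-- The set `I_μ = {1, …, n-1} ∖ {μ_1, μ_1 + μ_2, …, μ_1 + ⋯ + μ_{d-1}}`, in the indexing of
`{1, …, n-1}` by `Fin (n - 1)`. (The last partial sum `μ_1 + ⋯ + μ_d = n`, which is allowed below,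
is not in `{1, …, n-1}`.) -/
def Comp.I {d n : ℕ} (μ : Comp d n) : Set (Fin (n - 1)) :=
  {i | ∀ a : Fin d, ∑ b ∈ Finset.Iic a, μ.1 b ≠ (i : ℕ) + 1}

/-- The subalgebra `H^μ` of `H_n` generated by the `T_i` with `i ∈ I_μ`. -/
def HeckeSub {d n : ℕ} (μ : Comp d n) : Subalgebra BaseRing (Hecke n) :=
  Algebra.adjoin BaseRing (Hecke.T '' μ.I)

/-! ### The Yokonuma--Hecke algebra -/

/-- The generators `g_1, …, g_{n-1}, t_1, …, t_n`, with indices shifted to start at `0`. -/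
inductive YGen (n : ℕ) : Type
  | g (i : Fin (n - 1)) : YGen n
  | t (j : Fin n) : YGen n

/-- The position `i` of `{1, …, n}`, for `i ∈ {1, …, n-1}`. -/
def pos {n : ℕ} (i : Fin (n - 1)) : Fin n := ⟨i, by omega⟩

/-- The position `i + 1` of `{1, …, n}`, for `i ∈ {1, …, n-1}`. -/
def posSucc {n : ℕ} (i : Fin (n - 1)) : Fin n := ⟨i + 1, by omega⟩

/-- The generator `g_i` of the free algebra. -/
def freeg {n : ℕ} (i : Fin (n - 1)) : FreeAlgebra BaseRing (YGen n) :=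
  FreeAlgebra.ι BaseRing (YGen.g i)

/-- The generator `t_j` of the free algebra. -/
def freet {n : ℕ} (j : Fin n) : FreeAlgebra BaseRing (YGen n) :=
  FreeAlgebra.ι BaseRing (YGen.t j)

/-- The element `e_i = (1/d) ∑_{0 ≤ s ≤ d-1} t_i^s t_{i+1}^{-s}`. Since `t_{i+1}^d = 1` is one of
the relations, `t_{i+1}^{-s}` is written `t_{i+1}^{d-s}`. -/
def freee (d : ℕ) {n : ℕ} (i : Fin (n - 1)) : FreeAlgebra BaseRing (YGen n) :=
  const (1 / (d : ℂ)) • ∑ s ∈ Finset.range d, freet (pos i) ^ s * freet (posSucc i) ^ (d - s)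

/-- The defining relations of the Yokonuma--Hecke algebra. -/
inductive YRel (d n : ℕ) :
    FreeAlgebra BaseRing (YGen n) → FreeAlgebra BaseRing (YGen n) → Prop
  | comm (i j : Fin (n - 1)) (hij : 1 < |(i : ℤ) - (j : ℤ)|) :
      YRel d n (freeg i * freeg j) (freeg j * freeg i)
  | braid (i j : Fin (n - 1)) (hij : (j : ℕ) = (i : ℕ) + 1) :
      YRel d n (freeg i * freeg j * freeg i) (freeg j * freeg i * freeg j)
  | tcomm (i j : Fin n) : YRel d n (freet i * freet j) (freet j * freet i)
  | gt (i : Fin (n - 1)) (j : Fin n) :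
      YRel d n (freeg i * freet j) (freet (Equiv.swap (pos i) (posSucc i) j) * freeg i)
  | tpow (j : Fin n) : YRel d n (freet j ^ d) 1
  | quad (i : Fin (n - 1)) :
      YRel d n (freeg i ^ 2) (algebraMap BaseRing _ (u ^ 2) + v • (freee d i * freeg i))

/-- The Yokonuma--Hecke algebra `Y_{d,n}` over `ℂ[u^{±1}, v]`. -/
def Yokonuma (d n : ℕ) : Type := RingQuot (YRel d n)

instance (d n : ℕ) : Ring (Yokonuma d n) := RingQuot.instRing (YRel d n)

instance (d n : ℕ) : Algebra BaseRing (Yokonuma d n) :=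
  RingQuot.instAlgebra (YRel d n)

/-! ### Specializations -/

section Specialized

variable {R : Type*} [CommRing R] (θ : BaseRing →+* R) (B : Type) [Ring B] [Algebra BaseRing B]

/-- The specialized algebra `R_θ B = R ⊗ B`, the tensor product over `ℂ[u^{±1}, v]` being defined
via the ring homomorphism `θ : ℂ[u^{±1}, v] → R`. -/
def Specialized : Type _ :=
  letI : Algebra BaseRing R := θ.toAlgebra
  R ⊗[BaseRing] B

instance : Ring (Specialized θ B) :=
  letI : Algebra BaseRing R := θ.toAlgebra
  (Algebra.TensorProduct.instRing : Ring (R ⊗[BaseRing] B))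

instance : Algebra R (Specialized θ B) :=
  letI : Algebra BaseRing R := θ.toAlgebra
  (Algebra.TensorProduct.leftAlgebra : Algebra R (R ⊗[BaseRing] B))

end Specialized

end

end YokonumaHecke

/-!
Let `X` be the set of words `χ` of length `n` in `d` letters, and let `ζ` be a primitive `d`-th root
of unity. The commuting elements `t_j` decompose the unit of `Y = Y_{d,n}` into orthogonal
idempotents `E_χ` with `t_j E_χ = ζ^{χ j} E_χ`, and `g_i E_χ = E_{χ s_i} g_i`. If
`χ i ≠ χ (i + 1)`, then `g_i² E_χ = u² E_χ`, so `g_i` identifies `E_χ` with `E_{χ s_i}` up to a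
unit.
Every `E_χ` is therefore equivalent to the idempotent `E_μ` of a weakly increasing word, and such a
word is determined by its content `μ ∈ Comp_d(n)`. Hence `∑_μ E_μ` is a full idempotent
(`exists_E_eq_mul`), and `Y` is Morita equivalent to the corner it cuts out
(`isMoritaEquivalent_of_full_corner`). It remains to show that this corner is `∏_μ H^μ`.

* The elements `g_i + v f_i`, where `f_i` projects onto the words with a descent at `i`, satisfy the
  relations of the Hecke algebra, which gives `Φ : H_n → Y` (`heckeHom`). On `H^μ` it commutes with
  `E_μ`, so `x ↦ Φ(x) E_μ` is multiplicative from `H^μ` to `E_μ Y E_μ`.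
* This map is injective: `Y` acts on the functions `X → H_n`, with `g_i` acting through `T_i` or
  through `T_i - v = u² T_i⁻¹`, and in this representation `Φ(x) E_μ` multiplies the value at the
  sorted word by `x` (`eq_zero_of_heckeHom_mul_E`). No basis of `H_n` or of `Y` is needed, and no
  presentation of the subalgebra `H^μ`.
* It is surjective, and `E_μ Y E_ν = 0` for `μ ≠ ν`: bubble sort produces elements `G_χ` of
  `E_χ Y E_μ` (`sortElt`), well defined by the braid relations, and the span of the `G_χ Φ(x)` with
  `x ∈ H^μ` is stable under the generators of `Y` (`mul_E_mem_sortSpan`). The point is that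
  `g_i G_χ = G_χ Φ(T_p)` for some `p ∈ I_μ` when `χ i = χ (i + 1)` (`g_mul_sortElt_of_eq`).

All of this happens over `ℂ[u^{±1}, v]`. The outcome is recorded as a `CornerSystem`, a collection
of linear maps subject to identities, which is stable under every specialization.
-/

namespace YokonumaHecke

noncomputable section

universe u₀ u v w

/-! ### Morita equivalence with a full corner -/

section MoritaCorner

open CategoryTheory

variable {R : Type u₀} [CommRing R] {B C : Type u} [Ring B] [Ring C] [Algebra R B] [Algebra R C]

/-- The image `eM` of a `B`-module `M` under the idempotent `e = φ 1`, for a multiplicative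
linear map `φ : C → B` that need not preserve the unit. -/
def CornerModule (φ : C →ₙₐ[R] B) (M : Type*) [AddCommGroup M] [Module B M] : AddSubgroup M where
  carrier := {m | φ 1 • m = m}
  add_mem' {a b} ha hb := by
    change φ 1 • (a + b) = a + b
    rw [smul_add, ha, hb]
  zero_mem' := smul_zero _
  neg_mem' {a} ha := by
    change φ 1 • (-a) = -a
    rw [smul_neg, ha]

namespace CornerModule

variable {φ : C →ₙₐ[R] B} {M N : Type*} [AddCommGroup M] [Module B M] [AddCommGroup N] [Module B N]

lemma one_smul_coe (m : CornerModule φ M) : φ 1 • (m : M) = m := m.2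

lemma smul_mem (c : C) (m : M) : φ c • m ∈ CornerModule φ M := by
  change φ 1 • φ c • m = _
  rw [smul_smul, ← map_mul, one_mul]

instance : Module C (CornerModule φ M) where
  smul c m := ⟨φ c • m, smul_mem c _⟩
  one_smul m := Subtype.ext m.2
  mul_smul c c' m := Subtype.ext (by
    change φ (c * c') • (m : M) = φ c • φ c' • (m : M)
    rw [map_mul, mul_smul])
  smul_zero c := Subtype.ext (smul_zero _)
  smul_add c m m' := Subtype.ext (smul_add _ _ _)
  add_smul c c' m := Subtype.ext (by
    change φ (c + c') • (m : M) = φ c • (m : M) + φ c' • (m : M)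
    rw [map_add, add_smul])
  zero_smul m := Subtype.ext (by
    change φ 0 • (m : M) = 0
    rw [map_zero, zero_smul])

@[simp] lemma coe_smul (c : C) (m : CornerModule φ M) :
    ((c • m : CornerModule φ M) : M) = φ c • (m : M) := rfl

/-- A `B`-linear map restricts to a `C`-linear map between the images of the idempotent. -/
def map (f : M →ₗ[B] N) : CornerModule φ M →ₗ[C] CornerModule φ N where
  toFun m := ⟨f m, by
    change φ 1 • f m = f m
    rw [← map_smul, one_smul_coe]⟩
  map_add' m m' := Subtype.ext (map_add f _ _)
  map_smul' c m := Subtype.ext (map_smul f _ _)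

/-- The element `e m` of `eM`. -/
def proj (φ : C →ₙₐ[R] B) (m : M) : CornerModule φ M := ⟨φ 1 • m, smul_mem 1 m⟩

@[simp] lemma coe_proj (m : M) : (proj φ m : M) = φ 1 • m := rfl

lemma proj_add (m m' : M) : proj φ (m + m') = proj φ m + proj φ m' := Subtype.ext (smul_add _ _ _)

lemma proj_sum {ι : Type*} (s : Finset ι) (m : ι → M) :
    proj φ (∑ i ∈ s, m i) = ∑ i ∈ s, proj φ (m i) :=
  map_sum (AddMonoidHom.mk' (proj φ) proj_add) m s

/-- The coinduced module `Hom_C(eB, N)`, with `B` acting through right multiplication on `eB`. -/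
def Coind (φ : C →ₙₐ[R] B) (N : Type*) [AddCommGroup N] [Module C N] : Type _ :=
  CornerModule φ B →ₗ[C] N

section CoinducedModule

variable {P : Type*} [AddCommGroup P] [Module C P]

instance : AddCommGroup (Coind φ P) := inferInstanceAs (AddCommGroup (CornerModule φ B →ₗ[C] P))

/-- Right multiplication by `b` on the left `C`-module `eB`. -/
def mulRight (φ : C →ₙₐ[R] B) (b : B) : CornerModule φ B →ₗ[C] CornerModule φ B :=
  map (LinearMap.toSpanSingleton B B b)

@[simp] lemma coe_mulRight (b : B) (x : CornerModule φ B) : (mulRight φ b x : B) = x * b := rfl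

instance : Module B (Coind φ P) where
  smul b f := LinearMap.comp (show CornerModule φ B →ₗ[C] P from f) (mulRight φ b)
  one_smul f := LinearMap.ext fun _ => congrArg f.toFun (Subtype.ext (mul_one _))
  mul_smul _ _ f := LinearMap.ext fun _ => congrArg f.toFun (Subtype.ext (mul_assoc _ _ _).symm)
  smul_zero _ := rfl
  smul_add _ _ _ := rfl
  add_smul _ _ f := LinearMap.ext fun _ =>
    (congrArg f.toFun (Subtype.ext (mul_add _ _ _))).trans (f.map_add' _ _)
  zero_smul f := LinearMap.ext fun _ =>
    (congrArg f.toFun (Subtype.ext (mul_zero _))).trans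
      (map_zero (show CornerModule φ B →ₗ[C] P from f))

lemma Coind.smul_apply (b : B) (f : Coind φ P) (x : CornerModule φ B) :
    (b • f).toFun x = f.toFun (mulRight φ b x) := rfl

end CoinducedModule

end CornerModule

open CornerModule

/-- The functor `M ↦ eM`. -/
def cornerFunctor (φ : C →ₙₐ[R] B) : ModuleCat.{u} B ⥤ ModuleCat.{u} C where
  obj M := ModuleCat.of C (CornerModule φ M)
  map f := ModuleCat.ofHom (CornerModule.map f.hom)

variable (φ : C →ₙₐ[R] B)

/-- If every element of `eBe` comes from `C`, a `C`-linear map `eM → eN` is compatible with the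
action of `eBe`. -/
lemma corner_map_compat (hφ : ∀ b, ∃ c, φ c = φ 1 * b * φ 1) {M N : Type*}
    [AddCommGroup M] [Module B M] [AddCommGroup N] [Module B N]
    (f : CornerModule φ M →ₗ[C] CornerModule φ N) (b : B) (m : CornerModule φ M) :
    (f (proj φ (b • (m : M))) : N) = φ 1 • b • (f m : N) := by
  obtain ⟨c, hc⟩ := hφ b
  have h1 : proj φ (b • (m : M)) = c • m := Subtype.ext (by
    rw [coe_proj, coe_smul, hc, mul_smul, one_smul_coe, mul_smul])
  rw [h1, map_smul, coe_smul, hc, mul_smul, one_smul_coe, mul_smul]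

variable {ι : Type*} {s : Finset ι} {a b : ι → B}

lemma sum_smul_corner (hab : ∑ i ∈ s, a i * φ 1 * b i = 1) {M : Type*} [AddCommGroup M]
    [Module B M] (m : M) : ∑ i ∈ s, a i • (proj φ (b i • m) : M) = m := by
  simp only [coe_proj, smul_smul, ← Finset.sum_smul, ← mul_assoc, hab, one_smul]

lemma cornerFunctor_faithful (hab : ∑ i ∈ s, a i * φ 1 * b i = 1) :
    (cornerFunctor φ).Faithful where
  map_injective {M N} f g h := by
    ext m
    have h' : ∀ x : CornerModule φ M, f.hom x = g.hom x := fun x =>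
      congrArg Subtype.val (LinearMap.congr_fun (ModuleCat.hom_ext_iff.mp h) x)
    rw [← sum_smul_corner φ hab m]
    simp only [map_sum, map_smul, h']

lemma cornerFunctor_full (hφ : ∀ b, ∃ c, φ c = φ 1 * b * φ 1)
    (hab : ∑ i ∈ s, a i * φ 1 * b i = 1) : (cornerFunctor φ).Full where
  map_surjective {M N} f := by
    let f' : CornerModule φ M →ₗ[C] CornerModule φ N := f.hom
    have key (x : B) (m : M) : (f' (proj φ (x • m)) : N) =
        φ 1 • x • ∑ i ∈ s, a i • (f' (proj φ (b i • m)) : N) := by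
      conv_lhs => rw [← sum_smul_corner φ hab m, Finset.smul_sum, proj_sum, map_sum]
      simp only [AddSubgroup.val_finsetSum, smul_smul x, corner_map_compat φ hφ, Finset.smul_sum]
    refine ⟨ModuleCat.ofHom
      { toFun := fun m => ∑ i ∈ s, a i • (f' (proj φ (b i • m)) : N)
        map_add' := fun m m' => by
          simp only [smul_add, proj_add, map_add, AddSubgroup.coe_add, Finset.sum_add_distrib]
        map_smul' := fun x m => ?_ }, ?_⟩
    · simp only [RingHom.id_apply]
      conv_rhs => rw [← sum_smul_corner φ hab (x • _)]
      refine Finset.sum_congr rfl fun i _ => ?_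
      rw [smul_smul, key, coe_proj, mul_smul]
    · refine ModuleCat.hom_ext (LinearMap.ext fun (m : CornerModule φ M) => Subtype.ext ?_)
      change ∑ i ∈ s, a i • (f' (proj φ (b i • (m : M))) : N) = f' m
      simp only [corner_map_compat φ hφ, smul_smul, ← mul_assoc]
      rw [← Finset.sum_smul, hab, one_smul]

lemma cornerFunctor_essSurj (hinj : Function.Injective φ)
    (hφ : ∀ b, ∃ c, φ c = φ 1 * b * φ 1) : (cornerFunctor φ).EssSurj where
  mem_essImage P := by
    have hid : φ 1 * φ 1 = φ 1 := by rw [← map_mul, one_mul]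
    let ε : CornerModule φ B := ⟨φ 1, hid⟩
    -- Evaluation at `e`; its inverse sends `p` to `x ↦ c • p`, where `φ c = x e`.
    let ev : CornerModule φ (Coind φ P) →ₗ[C] P :=
      { toFun := fun f => (f : Coind φ P).toFun ε
        map_add' := fun f f' => rfl
        map_smul' := fun c f => by
          rw [coe_smul, Coind.smul_apply]
          refine Eq.trans (congrArg _ ?_) ((f : Coind φ P).map_smul' c ε)
          refine Subtype.ext ?_
          change φ 1 * φ c = φ c * φ 1
          rw [← map_mul, ← map_mul, one_mul, mul_one] }
    choose k hk using hφ
    have hk1 (x : CornerModule φ B) : φ (k x) = x * φ 1 := by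
      rw [hk, show φ 1 * (x : B) = x from x.2]
    have hbij : Function.Bijective ev := by
      constructor
      · rw [injective_iff_map_eq_zero]
        intro f hf
        refine Subtype.ext (LinearMap.ext fun x => ?_)
        have h1 : (f : Coind φ P) = φ 1 • (f : Coind φ P) := f.2.symm
        rw [h1]
        change (f : Coind φ P).toFun (mulRight φ (φ 1) x) = 0
        have h2 : mulRight φ (φ 1) x = k x • ε := Subtype.ext (by
          change (x : B) * φ 1 = φ (k x) * φ 1
          rw [hk1, mul_assoc, hid])
        rw [h2]
        refine ((f : Coind φ P).map_smul' (k x) ε).trans ?_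
        change k x • ev f = 0
        rw [hf, smul_zero]
      · intro p
        let f : Coind φ P :=
          { toFun := fun x => k x • p
            map_add' := fun x y => by
              rw [← add_smul]
              congr 1
              apply hinj
              rw [map_add, hk1, hk1, hk1, AddSubgroup.coe_add, add_mul]
            map_smul' := fun c x => by
              rw [RingHom.id_apply, ← mul_smul]
              congr 1
              apply hinj
              rw [map_mul, hk1, hk1, coe_smul, smul_eq_mul, mul_assoc] }
        refine ⟨⟨f, LinearMap.ext fun x => ?_⟩, ?_⟩
        · change k (mulRight φ (φ 1) x) • p = k x • p
          congr 1
          apply hinj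
          rw [hk1, hk1, coe_mulRight, mul_assoc, hid]
        · change k (ε : B) • p = p
          have : k (ε : B) = 1 := hinj (by rw [hk1]; exact hid)
          rw [this, one_smul]
    exact ⟨ModuleCat.of B (Coind φ P), ⟨(LinearEquiv.ofBijective ev hbij).toModuleIso⟩⟩

open scoped ModuleCat.Algebra in
lemma cornerFunctor_linear : (cornerFunctor φ).Linear R where
  map_smul {M N} f r := by
    refine ModuleCat.hom_ext (LinearMap.ext fun (m : CornerModule φ M) => Subtype.ext ?_)
    change algebraMap R B r • f.hom (m : M) = φ (algebraMap R C r) • f.hom (m : M)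
    have h : φ 1 • f.hom (m : M) = f.hom m := by rw [← map_smul, one_smul_coe]
    rw [Algebra.algebraMap_eq_smul_one (A := C), map_smul, Algebra.smul_def, mul_smul, h]

/-- A ring is Morita equivalent to its corner `eBe` at a full idempotent `e`; the corner is
presented as the image of an injective, multiplicative map `φ : C → B` with `φ 1 = e`. -/
theorem isMoritaEquivalent_of_full_corner (hinj : Function.Injective φ)
    (hφ : ∀ b, ∃ c, φ c = φ 1 * b * φ 1) (hab : ∑ i ∈ s, a i * φ 1 * b i = 1) :
    IsMoritaEquivalent R B C := by
  have := cornerFunctor_faithful φ hab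
  have := cornerFunctor_full φ hφ hab
  have := cornerFunctor_essSurj φ hinj hφ
  have : (cornerFunctor φ).IsEquivalence := {}
  exact ⟨⟨⟨(cornerFunctor φ).asEquivalence, cornerFunctor_linear φ⟩⟩⟩

end MoritaCorner

/-! ### Families of corners and extension of scalars -/

section CornerFamily

/-- Algebras `C μ` presented as the corners of an algebra `B` at idempotents `e μ = φ μ 1` which
are orthogonal in the strong sense `e μ B e ν = 0`, and whose sum is full. All conditions are
linear identities, hence stable under extension of scalars. -/
structure CornerSystem (R : Type u₀) [CommRing R] (B : Type u) [Ring B] [Algebra R B] {ι : Type v}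
    (C : ι → Type w) [∀ μ, Ring (C μ)] [∀ μ, Algebra R (C μ)] where
  /-- The embedding of the corner; it is multiplicative, with `φ μ 1 = e μ`. -/
  φ (μ : ι) : C μ →ₗ[R] B
  /-- The compression `b ↦ e μ * b * e μ`, read in `C μ`. -/
  ρ (μ : ι) : B →ₗ[R] C μ
  φ_mul (μ : ι) (x y : C μ) : φ μ (x * y) = φ μ x * φ μ y
  ρ_φ (μ : ι) (x : C μ) : ρ μ (φ μ x) = x
  φ_ρ (μ : ι) (b : B) : φ μ (ρ μ b) = φ μ 1 * b * φ μ 1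
  orth (μ ν : ι) (hμν : μ ≠ ν) (b : B) : φ μ 1 * b * φ ν 1 = 0
  full : ∃ (κ : Type) (_ : Fintype κ) (m : κ → ι) (a b : κ → B), ∑ k, a k * φ (m k) 1 * b k = 1

namespace CornerSystem

variable {R : Type u₀} [CommRing R] {B : Type u} [Ring B] [Algebra R B] {ι : Type v}

lemma mul_eq_zero {C : ι → Type w} [∀ μ, Ring (C μ)] [∀ μ, Algebra R (C μ)]
    (S : CornerSystem R B C) {μ ν : ι} (hμν : μ ≠ ν) (x : C μ) (b : B) (y : C ν) :
    S.φ μ x * b * S.φ ν y = 0 := by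
  have := S.orth μ ν hμν b
  calc S.φ μ x * b * S.φ ν y = S.φ μ (x * 1) * b * S.φ ν (1 * y) := by rw [mul_one, one_mul]
    _ = S.φ μ x * (S.φ μ 1 * b * S.φ ν 1) * S.φ ν y := by simp only [S.φ_mul, mul_assoc]
    _ = 0 := by rw [this, mul_zero, zero_mul]

open Classical in
/-- The sum of the idempotents of the system is a full idempotent of `B`, with corner `∏ C μ`. -/
theorem isMoritaEquivalent [Finite ι] {C : ι → Type (max u v)} [∀ μ, Ring (C μ)]
    [∀ μ, Algebra R (C μ)] {B : Type (max u v)} [Ring B] [Algebra R B]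
    (S : CornerSystem R B C) : IsMoritaEquivalent R B (∀ μ, C μ) := by
  have := Fintype.ofFinite ι
  have cross {μ ν : ι} (h : μ ≠ ν) (x : C μ) (y : C ν) : S.φ μ x * S.φ ν y = 0 := by
    simpa using S.mul_eq_zero h x 1 y
  let φ : (∀ μ, C μ) →ₙₐ[R] B :=
    { toFun := fun x => ∑ μ, S.φ μ (x μ)
      map_smul' := fun r x => by simp [Finset.smul_sum]
      map_zero' := by simp
      map_add' := fun x y => by simp [Finset.sum_add_distrib]
      map_mul' := fun x y => by
        simp only [Pi.mul_apply, S.φ_mul, Finset.sum_mul_sum]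
        refine Finset.sum_congr rfl fun μ _ => ?_
        rw [Finset.sum_eq_single μ (fun ν _ h => cross h.symm _ _) (by simp)] }
  have hφ (x : ∀ μ, C μ) : φ x = ∑ μ, S.φ μ (x μ) := rfl
  have hφρ (b : B) : φ (fun μ => S.ρ μ b) = φ 1 * b * φ 1 := by
    simp only [hφ, S.φ_ρ, Finset.sum_mul, Finset.mul_sum, Pi.one_apply]
    refine Finset.sum_congr rfl fun μ _ => ?_
    rw [Finset.sum_eq_single μ (fun ν _ h => S.orth _ _ h _) (by simp)]
  have hρφ (x : ∀ μ, C μ) (μ : ι) : S.ρ μ (φ x) = x μ := by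
    rw [hφ, map_sum, Finset.sum_eq_single μ _ (by simp), S.ρ_φ]
    intro ν _ h
    rw [← S.ρ_φ μ (S.ρ μ _), S.φ_ρ, cross h.symm, zero_mul, map_zero]
  obtain ⟨κ, _, m, a, b, hab⟩ := S.full
  refine isMoritaEquivalent_of_full_corner φ
    (fun x y hxy => funext fun μ => by rw [← hρφ x, ← hρφ y, hxy]) (fun b => ⟨_, hφρ b⟩)
    (s := Finset.univ) (a := fun k => a k * S.φ (m k) 1) (b := b) ?_
  rw [← hab]
  refine Finset.sum_congr rfl fun k _ => ?_
  rw [hφ, mul_assoc (a k), Finset.mul_sum, Finset.sum_eq_single (m k) _ (by simp), Pi.one_apply,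
    ← S.φ_mul, one_mul]
  intro ν _ h
  exact cross h.symm _ _

/-- Extension of scalars of a system of corners. -/
noncomputable def baseChange {C : ι → Type w} [∀ μ, Ring (C μ)] [∀ μ, Algebra R (C μ)]
    (S : CornerSystem R B C) (R' : Type*) [CommRing R'] [Algebra R R'] :
    CornerSystem R' (R' ⊗[R] B) (fun μ => R' ⊗[R] C μ) where
  φ μ := (S.φ μ).baseChange R'
  ρ μ := (S.ρ μ).baseChange R'
  φ_mul μ x y := by
    induction x with
    | zero => simp
    | add x x' hx hx' => simp only [add_mul, map_add, hx, hx']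
    | tmul r x =>
      induction y with
      | zero => simp
      | add y y' hy hy' => simp only [mul_add, map_add, hy, hy']
      | tmul r' y => simp [S.φ_mul]
  ρ_φ μ x := by
    induction x with
    | zero => simp
    | add x x' hx hx' => simp only [map_add, hx, hx']
    | tmul r x => simp [S.ρ_φ]
  φ_ρ μ b := by
    induction b with
    | zero => simp
    | add x x' hx hx' => simp only [mul_add, add_mul, map_add, hx, hx']
    | tmul r x => simp [S.φ_ρ, Algebra.TensorProduct.one_def]
  orth μ ν h b := by
    induction b with
    | zero => simp
    | add x x' hx hx' => simp only [mul_add, add_mul, hx, hx', add_zero]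
    | tmul r x => simp [S.orth μ ν h, Algebra.TensorProduct.one_def]
  full := by
    obtain ⟨κ, _, m, a, b, hab⟩ := S.full
    refine ⟨κ, inferInstance, m, fun k => 1 ⊗ₜ a k, fun k => 1 ⊗ₜ b k, ?_⟩
    simp only [Algebra.TensorProduct.one_def, LinearMap.baseChange_tmul,
      Algebra.TensorProduct.tmul_mul_tmul, one_mul, ← TensorProduct.tmul_sum, hab]

end CornerSystem

/-- A system of corners over `ℂ[u^{±1}, v]` yields a Morita equivalence after every
specialization. -/
theorem CornerSystem.isMoritaEquivalent_specialized {R : Type w} [CommRing R]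
    (θ : BaseRing →+* R) {B : Type} [Ring B] [Algebra BaseRing B] {ι : Type} [Finite ι]
    {C : ι → Type} [∀ μ, Ring (C μ)] [∀ μ, Algebra BaseRing (C μ)]
    (S : CornerSystem BaseRing B C) :
    IsMoritaEquivalent R (Specialized θ B) (∀ μ, Specialized θ (C μ)) := by
  let : Algebra BaseRing R := θ.toAlgebra
  exact (S.baseChange R).isMoritaEquivalent

end CornerFamily

/-! ### Roots of unity and simultaneous diagonalization -/

section Diagonalization

/-- The inclusion of the constants `ℂ` into `ℂ[u^{±1}, v]`. -/
def constHom : ℂ →+* BaseRing :=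
  (Polynomial.C : LaurentPolynomial ℂ →+* Polynomial (LaurentPolynomial ℂ)).comp LaurentPolynomial.C

lemma const_eq (z : ℂ) : const z = constHom z := rfl

/-- The inverse of `u`. -/
def uinv : BaseRing := Polynomial.C (LaurentPolynomial.T (-1))

lemma uinv_mul_u : uinv * u = 1 := by
  have h : (Polynomial.C (LaurentPolynomial.T (-1)) * Polynomial.C (LaurentPolynomial.T 1) :
      Polynomial (LaurentPolynomial ℂ)) = 1 := by
    rw [← Polynomial.C_mul, ← LaurentPolynomial.T_add]
    simp
  exact h

lemma u_mul_uinv : u * uinv = 1 := by rw [mul_comm, uinv_mul_u]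

/-- The standard primitive `d`-th root of unity. -/
def zeta (d : ℕ) : ℂ := Complex.exp (2 * Real.pi * Complex.I / d)

variable {d : ℕ}

lemma zeta_prim (hd : 1 ≤ d) : IsPrimitiveRoot (zeta d) d :=
  Complex.isPrimitiveRoot_exp d (by omega)

/-- The `a`-th `d`-th root of unity, as an element of the base ring. -/
def root (a : Fin d) : BaseRing := const (zeta d ^ (a : ℕ))

lemma isUnit_root_sub {a b : Fin d} (hab : a ≠ b) : IsUnit (root a - root b) := by
  have hd : 1 ≤ d := by have := a.2; omega
  rw [root, root, const_eq, const_eq, ← map_sub]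
  refine IsUnit.map constHom (sub_ne_zero.mpr fun h => hab (Fin.ext ?_)).isUnit
  exact (zeta_prim hd).pow_inj a.2 b.2 h

lemma root_pow (a : Fin d) : root a ^ d = 1 := by
  have hd : 1 ≤ d := by have := a.2; omega
  rw [root, const_eq, ← map_pow, pow_right_comm, (zeta_prim hd).pow_eq_one, one_pow, map_one]

/-- The spectral projections of an element `x` with `x ^ d = 1`. -/
def rootProj {S : Type*} [CommRing S] [Algebra BaseRing S] (x : S) (a : Fin d) : S :=
  const (1 / (d : ℂ)) • ∑ s ∈ Finset.range d, x ^ s * algebraMap BaseRing S (root a) ^ (d - s)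

lemma mul_rootProj {S : Type*} [CommRing S] [Algebra BaseRing S] {x : S} (hx : x ^ d = 1)
    (a : Fin d) : x * rootProj x a = root a • rootProj x a := by
  have h3 : ∑ s ∈ Finset.range d, x ^ s * algebraMap BaseRing S (root a) ^ (d - s) =
      (∑ s ∈ Finset.range d, x ^ s * algebraMap BaseRing S (root a) ^ (d - 1 - s)) *
        algebraMap BaseRing S (root a) := by
    rw [Finset.sum_mul]
    refine Finset.sum_congr rfl fun s hs => ?_
    rw [mul_assoc, ← pow_succ]
    congr 2
    have := Finset.mem_range.mp hs
    omega
  have h2 := (Commute.all x (algebraMap BaseRing S (root a))).geom_sum₂_mul d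
  rw [hx, ← map_pow, root_pow, map_one, sub_self] at h2
  rw [← sub_eq_zero, Algebra.smul_def (root a), ← sub_mul, rootProj, mul_smul_comm, h3, ← mul_assoc,
    mul_comm (x - _), h2, zero_mul, smul_zero]

/-- Orthogonality of the characters of `ℤ/d`. -/
lemma sum_root_pow (a b : Fin d) :
    const (1 / (d : ℂ)) * ∑ s ∈ Finset.range d, root a ^ s * root b ^ (d - s) =
      if a = b then 1 else 0 := by
  have hd : 1 ≤ d := by have := a.2; omega
  split_ifs with h
  · subst h
    rw [Finset.sum_congr rfl (g := fun _ => 1), Finset.sum_const, Finset.card_range, nsmul_one,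
      const_eq, ← map_natCast constHom, ← map_mul, one_div_mul_cancel, map_one]
    · exact_mod_cast (by omega : d ≠ 0)
    · intro s hs
      rw [← pow_add, Nat.add_sub_cancel' (Finset.mem_range.mp hs).le, root_pow]
  · have h1 : root a * rootProj (root a) b = root b * rootProj (root a) b :=
      mul_rootProj (root_pow a) b
    rw [← sub_eq_zero, ← sub_mul] at h1
    exact (isUnit_root_sub h).mul_right_eq_zero.mp h1

lemma sum_rootProj {S : Type*} [CommRing S] [Algebra BaseRing S] (hd : 1 ≤ d) (x : S) :
    ∑ a : Fin d, rootProj x a = 1 := by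
  have hsum (s : ℕ) (hs : s < d) :
      ∑ a : Fin d, root a ^ (d - s) = if s = 0 then (d : BaseRing) else 0 := by
    split_ifs with h
    · subst h
      simp [root_pow]
    · have h1 : ∑ a : Fin d, root a ^ (d - s) =
          constHom (∑ a ∈ Finset.range d, (zeta d ^ (d - s)) ^ a) := by
        rw [map_sum, ← Fin.sum_univ_eq_sum_range (fun a => constHom ((zeta d ^ (d - s)) ^ a))]
        refine Finset.sum_congr rfl fun a _ => ?_
        rw [root, const_eq, ← map_pow, pow_right_comm]
      have h2 : zeta d ^ (d - s) - 1 ≠ 0 := sub_ne_zero.mpr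
        ((zeta_prim hd).pow_ne_one_of_pos_of_lt (by omega) (by omega))
      have h3 := geom_sum_mul (zeta d ^ (d - s)) d
      rw [pow_right_comm, (zeta_prim hd).pow_eq_one, one_pow, sub_self] at h3
      rw [h1, (mul_eq_zero.mp h3).resolve_right h2, map_zero]
  simp only [rootProj, ← Finset.smul_sum]
  rw [Finset.sum_comm]
  simp only [← Finset.mul_sum, ← map_pow, ← map_sum]
  rw [Finset.sum_congr rfl fun s hs => by rw [hsum s (Finset.mem_range.mp hs)],
    Finset.sum_eq_single 0 (fun s _ hs => by simp [hs]) (fun h => by simp at h; omega), if_pos rfl,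
    pow_zero, one_mul, Algebra.smul_def, ← map_mul, const_eq, ← map_natCast constHom, ← map_mul,
    one_div_mul_cancel, map_one, map_one]
  exact_mod_cast (by omega : d ≠ 0)

/-- Commuting elements `t j` of order dividing `d` are simultaneously diagonalizable: there is a
decomposition of the unit into simultaneous eigenvectors. -/
lemma exists_eigen_decomposition {d n : ℕ} (hd : 1 ≤ d) {B : Type*} [Ring B] [Algebra BaseRing B]
    (t : Fin n → B) (hcomm : ∀ i j, t i * t j = t j * t i) (hpow : ∀ j, t j ^ d = 1) :
    ∃ E : (Fin n → Fin d) → B, ∑ χ, E χ = 1 ∧ (∀ j χ, t j * E χ = root (χ j) • E χ) ∧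
      ∀ j χ, E χ * t j = root (χ j) • E χ := by
  let S := Algebra.adjoin BaseRing (Set.range t)
  have : IsMulCommutative S := Algebra.isMulCommutative_adjoin BaseRing (by
    rintro _ ⟨i, rfl⟩ _ ⟨j, rfl⟩
    exact hcomm i j)
  let : CommRing S := { (inferInstance : Ring S) with mul_comm := fun x y => this.is_comm.comm x y }
  let τ (j : Fin n) : S := ⟨t j, Algebra.subset_adjoin ⟨j, rfl⟩⟩
  have hτ (j : Fin n) : τ j ^ d = 1 := Subtype.ext (hpow j)
  let E (χ : Fin n → Fin d) : S := ∏ j, rootProj (τ j) (χ j)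
  have hE (j : Fin n) (χ : Fin n → Fin d) : τ j * E χ = root (χ j) • E χ := by
    change τ j * ∏ j, rootProj (τ j) (χ j) = root (χ j) • ∏ j, rootProj (τ j) (χ j)
    rw [← Finset.mul_prod_erase _ _ (Finset.mem_univ j), ← mul_assoc, mul_rootProj (hτ j),
      smul_mul_assoc]
  have hsum : ∑ χ, E χ = 1 := by
    have := Finset.prod_univ_sum (fun _ : Fin n => (Finset.univ : Finset (Fin d)))
      (fun j a => rootProj (τ j) a)
    simp only [sum_rootProj hd, Finset.prod_const_one, Fintype.piFinset_univ] at this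
    exact this.symm
  refine ⟨fun χ => (E χ : B), ?_, fun j χ => congrArg Subtype.val (hE j χ), fun j χ => ?_⟩
  · exact (map_sum S.val E _).symm.trans (congrArg Subtype.val hsum)
  · exact congrArg Subtype.val ((mul_comm (E χ) (τ j)).trans (hE j χ))

end Diagonalization

/-! ### Simple transpositions, generators and universal properties -/

section Generators

/-- The simple transposition `s_i` of the positions. -/
def simpleSwap {n : ℕ} (i : Fin (n - 1)) : Equiv.Perm (Fin n) := Equiv.swap (pos i) (posSucc i)

section SimpleSwap

variable {n : ℕ} {X : Type*} (χ : Fin n → X)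

@[simp] lemma simpleSwap_pos (i : Fin (n - 1)) : simpleSwap i (pos i) = posSucc i :=
  Equiv.swap_apply_left _ _

@[simp] lemma simpleSwap_posSucc (i : Fin (n - 1)) : simpleSwap i (posSucc i) = pos i :=
  Equiv.swap_apply_right _ _

lemma simpleSwap_of_ne {i : Fin (n - 1)} {j : Fin n} (h1 : (j : ℕ) ≠ i) (h2 : (j : ℕ) ≠ i + 1) :
    simpleSwap i j = j :=
  Equiv.swap_apply_of_ne_of_ne (by simpa [pos, Fin.ext_iff] using h1)
    (by simpa [posSucc, Fin.ext_iff] using h2)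

@[simp] lemma simpleSwap_simpleSwap (i : Fin (n - 1)) (j : Fin n) :
    simpleSwap i (simpleSwap i j) = j := Equiv.swap_apply_self _ _ _

@[simp] lemma comp_simpleSwap_comp_simpleSwap (i : Fin (n - 1)) :
    (χ ∘ simpleSwap i) ∘ simpleSwap i = χ := by
  ext j; simp

lemma simpleSwap_pos_of_far {i j : Fin (n - 1)} (hij : 1 < |(i : ℤ) - (j : ℤ)|) :
    simpleSwap i (pos j) = pos j := by
  rw [lt_abs] at hij
  exact simpleSwap_of_ne (by simp [pos]; omega) (by simp [pos]; omega)

lemma simpleSwap_posSucc_of_far {i j : Fin (n - 1)} (hij : 1 < |(i : ℤ) - (j : ℤ)|) :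
    simpleSwap i (posSucc j) = posSucc j := by
  rw [lt_abs] at hij
  exact simpleSwap_of_ne (by simp [posSucc]; omega) (by simp [posSucc]; omega)

lemma pos_of_adj {i j : Fin (n - 1)} (hij : (j : ℕ) = i + 1) : pos j = posSucc i := Fin.ext hij

lemma simpleSwap_left_posSucc {i j : Fin (n - 1)} (hij : (j : ℕ) = i + 1) :
    simpleSwap i (posSucc j) = posSucc j :=
  simpleSwap_of_ne (by simp [posSucc]; omega) (by simp [posSucc]; omega)

lemma simpleSwap_right_pos {i j : Fin (n - 1)} (hij : (j : ℕ) = i + 1) :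
    simpleSwap j (pos i) = pos i :=
  simpleSwap_of_ne (by simp [pos]; omega) (by simp [pos]; omega)

lemma simpleSwap_right_posSucc_left {i j : Fin (n - 1)} (hij : (j : ℕ) = i + 1) :
    simpleSwap j (posSucc i) = posSucc j := by rw [← pos_of_adj hij, simpleSwap_pos]

lemma simpleSwap_right_posSucc {i j : Fin (n - 1)} (hij : (j : ℕ) = i + 1) :
    simpleSwap j (posSucc j) = posSucc i := by rw [simpleSwap_posSucc, pos_of_adj hij]

lemma simpleSwap_comm {i j : Fin (n - 1)} (hij : 1 < |(i : ℤ) - (j : ℤ)|) (k : Fin n) :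
    simpleSwap i (simpleSwap j k) = simpleSwap j (simpleSwap i k) := by
  have : Equiv.Perm.Disjoint (simpleSwap i) (simpleSwap j) := by
    intro k
    by_contra! h
    have h1 : (k : ℕ) = i ∨ (k : ℕ) = i + 1 := by
      by_contra! h'
      exact h.1 (simpleSwap_of_ne h'.1 h'.2)
    have h2 : (k : ℕ) = j ∨ (k : ℕ) = j + 1 := by
      by_contra! h'
      exact h.2 (simpleSwap_of_ne h'.1 h'.2)
    rw [lt_abs] at hij
    omega
  exact Equiv.congr_fun this.commute.eq k

lemma simpleSwap_braid {i j : Fin (n - 1)} (hij : (j : ℕ) = i + 1) (k : Fin n) :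
    simpleSwap i (simpleSwap j (simpleSwap i k)) =
      simpleSwap j (simpleSwap i (simpleSwap j k)) := by
  have h0 := pos_of_adj hij
  have h1 := simpleSwap_left_posSucc hij
  have h2 := simpleSwap_right_pos hij
  have h3 := simpleSwap_right_posSucc_left hij
  have h4 := simpleSwap_right_posSucc hij
  by_cases e1 : k = pos i
  · subst e1; simp only [h1, h2, h3, simpleSwap_pos]
  by_cases e2 : k = posSucc i
  · subst e2; simp only [h1, h2, h3, simpleSwap_posSucc, simpleSwap_pos, h0]
  by_cases e3 : k = posSucc j
  · subst e3; simp only [h1, h2, h4, simpleSwap_posSucc]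
  have f1 : simpleSwap i k = k := Equiv.swap_apply_of_ne_of_ne e1 e2
  have f2 : simpleSwap j k = k := Equiv.swap_apply_of_ne_of_ne (h0 ▸ e2) e3
  simp only [f1, f2]

/-- The indices `i` such that `ψ` has equal letters in positions `i` and `i + 1`. -/
def plateau (ψ : Fin n → X) : Set (Fin (n - 1)) := {i | ψ (pos i) = ψ (posSucc i)}

lemma comp_simpleSwap_of_mem_plateau {ψ : Fin n → X} {i : Fin (n - 1)} (hi : i ∈ plateau ψ) :
    ψ ∘ simpleSwap i = ψ := by
  ext j
  rw [Function.comp_apply, simpleSwap, Equiv.swap_apply_def]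
  have hi' : ψ (pos i) = ψ (posSucc i) := hi
  split_ifs with h1 h2
  · rw [h1, hi']
  · rw [h2, hi']
  · rfl

end SimpleSwap

lemma Hecke.T_comm {n : ℕ} {i j : Fin (n - 1)} (hij : 1 < |(i : ℤ) - (j : ℤ)|) :
    (T i * T j : Hecke n) = T j * T i := by
  simpa only [map_mul] using! RingQuot.mkAlgHom_rel BaseRing (HeckeRel.comm i j hij)

lemma Hecke.T_braid {n : ℕ} {i j : Fin (n - 1)} (hij : (j : ℕ) = i + 1) :
    (T i * T j * T i : Hecke n) = T j * T i * T j := by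
  simpa only [map_mul] using! RingQuot.mkAlgHom_rel BaseRing (HeckeRel.braid i j hij)

lemma Hecke.T_mul_self {n : ℕ} (i : Fin (n - 1)) :
    (T i * T i : Hecke n) = algebraMap BaseRing _ (u ^ 2) + v • T i := by
  simpa only [map_mul, map_add, map_smul, AlgHom.commutes, map_pow, ← pow_two] using!
    RingQuot.mkAlgHom_rel BaseRing (HeckeRel.quad i)

/-- The universal property of the Iwahori--Hecke algebra. -/
def Hecke.lift {n : ℕ} {B : Type*} [Ring B] [Algebra BaseRing B] (x : Fin (n - 1) → B)
    (comm : ∀ i j : Fin (n - 1), 1 < |(i : ℤ) - (j : ℤ)| → x i * x j = x j * x i)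
    (braid : ∀ i j : Fin (n - 1), (j : ℕ) = i + 1 → x i * x j * x i = x j * x i * x j)
    (quad : ∀ i, x i * x i = algebraMap BaseRing _ (u ^ 2) + v • x i) :
    Hecke n →ₐ[BaseRing] B :=
  RingQuot.liftAlgHom BaseRing ⟨FreeAlgebra.lift BaseRing x, by
    intro a b h
    cases h with
    | comm i j hij => simpa [freeT] using comm i j hij
    | braid i j hij => simpa [freeT] using braid i j hij
    | quad i => simpa [freeT, pow_two] using quad i⟩

@[simp] lemma Hecke.lift_T {n : ℕ} {B : Type*} [Ring B] [Algebra BaseRing B] (x : Fin (n - 1) → B)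
    (comm braid quad) (i : Fin (n - 1)) : Hecke.lift x comm braid quad (T i) = x i := by
  change RingQuot.liftAlgHom BaseRing _ (RingQuot.mkAlgHom BaseRing (HeckeRel n) (freeT i)) = _
  rw [RingQuot.liftAlgHom_mkAlgHom_apply]
  simp [freeT]

namespace Yokonuma

variable {d n : ℕ}

/-- The quotient map from the free algebra to `Y_{d,n}`. -/
def mk (d n : ℕ) : FreeAlgebra BaseRing (YGen n) →ₐ[BaseRing] Yokonuma d n :=
  RingQuot.mkAlgHom BaseRing (YRel d n)

/-- The generator `g_i` of `Y_{d,n}`. -/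
def g (i : Fin (n - 1)) : Yokonuma d n := mk d n (freeg i)

/-- The generator `t_j` of `Y_{d,n}`. -/
def t (j : Fin n) : Yokonuma d n := mk d n (freet j)

lemma g_comm {i j : Fin (n - 1)} (hij : 1 < |(i : ℤ) - (j : ℤ)|) :
    (g i * g j : Yokonuma d n) = g j * g i := by
  simpa only [map_mul] using! RingQuot.mkAlgHom_rel BaseRing (YRel.comm (d := d) i j hij)

lemma g_braid {i j : Fin (n - 1)} (hij : (j : ℕ) = i + 1) :
    (g i * g j * g i : Yokonuma d n) = g j * g i * g j := by
  simpa only [map_mul] using! RingQuot.mkAlgHom_rel BaseRing (YRel.braid (d := d) i j hij)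

lemma t_comm (i j : Fin n) : (t i * t j : Yokonuma d n) = t j * t i := by
  simpa only [map_mul] using! RingQuot.mkAlgHom_rel BaseRing (YRel.tcomm (d := d) i j)

lemma g_mul_t (i : Fin (n - 1)) (j : Fin n) :
    (g i * t j : Yokonuma d n) = t (simpleSwap i j) * g i := by
  simpa only [map_mul] using! RingQuot.mkAlgHom_rel BaseRing (YRel.gt (d := d) i j)

lemma t_pow (j : Fin n) : (t j ^ d : Yokonuma d n) = 1 := by
  simpa only [map_pow, map_one] using! RingQuot.mkAlgHom_rel BaseRing (YRel.tpow (d := d) j)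

lemma g_mul_self (i : Fin (n - 1)) :
    (g i * g i : Yokonuma d n) = algebraMap BaseRing _ (u ^ 2) +
      v • ((const (1 / (d : ℂ)) • ∑ s ∈ Finset.range d, t (pos i) ^ s * t (posSucc i) ^ (d - s)) *
        g i) := by
  simpa only [map_mul, map_add, map_smul, AlgHom.commutes, map_pow, ← pow_two, freee, map_sum]
    using! RingQuot.mkAlgHom_rel BaseRing (YRel.quad (d := d) i)

/-- The universal property of the Yokonuma--Hecke algebra. -/
def lift {B : Type*} [Ring B] [Algebra BaseRing B] (x : Fin (n - 1) → B) (y : Fin n → B)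
    (comm : ∀ i j : Fin (n - 1), 1 < |(i : ℤ) - (j : ℤ)| → x i * x j = x j * x i)
    (braid : ∀ i j : Fin (n - 1), (j : ℕ) = i + 1 → x i * x j * x i = x j * x i * x j)
    (tcomm : ∀ i j, y i * y j = y j * y i) (gt : ∀ i j, x i * y j = y (simpleSwap i j) * x i)
    (tpow : ∀ j, y j ^ d = 1)
    (quad : ∀ i, x i * x i = algebraMap BaseRing _ (u ^ 2) + v • ((const (1 / (d : ℂ)) •
      ∑ s ∈ Finset.range d, y (pos i) ^ s * y (posSucc i) ^ (d - s)) * x i)) :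
    Yokonuma d n →ₐ[BaseRing] B :=
  RingQuot.liftAlgHom BaseRing ⟨FreeAlgebra.lift BaseRing fun
    | .g i => x i
    | .t j => y j, by
    intro a b h
    cases h with
    | comm i j hij => simpa [freeg] using comm i j hij
    | braid i j hij => simpa [freeg] using braid i j hij
    | tcomm i j => simpa [freet] using tcomm i j
    | gt i j => simpa [freet, freeg, simpleSwap] using gt i j
    | tpow j => simpa [freet] using tpow j
    | quad i => simpa [freeg, freet, freee, pow_two] using quad i⟩

@[simp] lemma lift_g {B : Type*} [Ring B] [Algebra BaseRing B] (x : Fin (n - 1) → B) (y : Fin n → B)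
    (comm braid tcomm gt) (tpow : ∀ j, y j ^ d = 1) (quad) (i : Fin (n - 1)) :
    lift x y comm braid tcomm gt tpow quad (g i) = x i := by
  change RingQuot.liftAlgHom BaseRing _ (RingQuot.mkAlgHom BaseRing (YRel d n) (freeg i)) = _
  rw [RingQuot.liftAlgHom_mkAlgHom_apply]
  simp [freeg]

@[simp] lemma lift_t {B : Type*} [Ring B] [Algebra BaseRing B] (x : Fin (n - 1) → B) (y : Fin n → B)
    (comm braid tcomm gt) (tpow : ∀ j, y j ^ d = 1) (quad) (j : Fin n) :
    lift x y comm braid tcomm gt tpow quad (t j) = y j := by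
  change RingQuot.liftAlgHom BaseRing _ (RingQuot.mkAlgHom BaseRing (YRel d n) (freet j)) = _
  rw [RingQuot.liftAlgHom_mkAlgHom_apply]
  simp [freet]

/-- A submodule stable under left multiplication by the generators is a left ideal. -/
lemma mul_mem_of_generators {N : Submodule BaseRing (Yokonuma d n)}
    (hg : ∀ i, ∀ x ∈ N, g i * x ∈ N) (ht : ∀ j, ∀ x ∈ N, t j * x ∈ N) (y : Yokonuma d n)
    {x : Yokonuma d n} (hx : x ∈ N) : y * x ∈ N := by
  obtain ⟨a, rfl⟩ : ∃ a, mk d n a = y := RingQuot.mkAlgHom_surjective BaseRing (YRel d n) y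
  induction a using FreeAlgebra.induction generalizing x with
  | grade0 r =>
    rw [AlgHom.commutes]
    exact (Algebra.smul_def r x) ▸ N.smul_mem r hx
  | grade1 k =>
    cases k with
    | g i => exact hg i x hx
    | t j => exact ht j x hx
  | mul a b ha hb =>
    rw [map_mul, mul_assoc]
    exact ha (hb hx)
  | add a b ha hb =>
    rw [map_add, add_mul]
    exact N.add_mem (ha hx) (hb hx)

end Yokonuma

end Generators

/-! ### The idempotents `E_χ` and the embedding of the Hecke algebra -/

section Embedding

-- Unfolding these instances exposes `RingQuot` and `Polynomial` behind the names of the algebras,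
-- and then the two paths from a ring to its additive monoid no longer unify.
attribute [local irreducible] instRingYokonuma instRingHecke instCommRingBaseRing

namespace Yokonuma

variable {d n : ℕ} [NeZero d]

lemma exists_E (d n : ℕ) [NeZero d] : ∃ E : (Fin n → Fin d) → Yokonuma d n, ∑ χ, E χ = 1 ∧
    (∀ j χ, t j * E χ = root (χ j) • E χ) ∧ ∀ j χ, E χ * t j = root (χ j) • E χ :=
  exists_eigen_decomposition (Nat.one_le_iff_ne_zero.mpr (NeZero.ne d)) t t_comm t_pow

/-- The idempotent `E_χ` attached to a character `χ` of `(ℤ/d)^n`, that is, to a word in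
`{1, …, d}` of length `n`: the projection onto the simultaneous eigenspace of the `t_j` with
eigenvalues `ζ^{χ j}`. -/
def E (χ : Fin n → Fin d) : Yokonuma d n := (exists_E d n).choose χ

lemma sum_E : ∑ χ, E χ = (1 : Yokonuma d n) := (exists_E d n).choose_spec.1

lemma t_mul_E (j : Fin n) (χ : Fin n → Fin d) : t j * E χ = root (χ j) • E χ :=
  (exists_E d n).choose_spec.2.1 j χ

lemma E_mul_t (j : Fin n) (χ : Fin n → Fin d) : E χ * t j = root (χ j) • E χ :=
  (exists_E d n).choose_spec.2.2 j χ

/-- The `E_χ` project a representation of `Y_{d,n}` onto the eigenspaces of the `t_j`. -/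
lemma E_apply_of_eigen {M : Type*} [AddCommGroup M] [Module BaseRing M]
    (π : Yokonuma d n →ₐ[BaseRing] Module.End BaseRing M) {m : M} {ψ : Fin n → Fin d}
    (h : ∀ j, π (t j) m = root (ψ j) • m) (χ : Fin n → Fin d) :
    π (E χ) m = if χ = ψ then m else 0 := by
  have h0 (χ : Fin n → Fin d) (hχ : χ ≠ ψ) : π (E χ) m = 0 := by
    obtain ⟨j, hj⟩ := Function.ne_iff.mp hχ
    have h1 : π (E χ) (π (t j) m) = root (χ j) • π (E χ) m := by
      rw [← Module.End.mul_apply, ← map_mul, E_mul_t, map_smul, LinearMap.smul_apply]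
    rw [h, map_smul, ← sub_eq_zero, ← sub_smul] at h1
    exact (isUnit_root_sub hj.symm).smul_eq_zero.mp h1
  split_ifs with hχ
  · subst hχ
    have h1 : π (∑ ψ, E ψ) m = m := by rw [sum_E, map_one, Module.End.one_apply]
    rwa [map_sum, LinearMap.sum_apply, Finset.sum_eq_single χ (fun ψ _ hψ => h0 ψ hψ) (by simp)]
      at h1
  · exact h0 χ hχ

lemma E_mul_of_eigen {x : Yokonuma d n} {ψ : Fin n → Fin d} (h : ∀ j, t j * x = root (ψ j) • x)
    (χ : Fin n → Fin d) : E χ * x = if χ = ψ then x else 0 :=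
  E_apply_of_eigen (Algebra.lmul BaseRing (Yokonuma d n)) h χ

lemma E_mul_E (χ ψ : Fin n → Fin d) : E χ * E ψ = if χ = ψ then E ψ else 0 :=
  E_mul_of_eigen (fun j => t_mul_E j ψ) χ

@[simp] lemma E_mul_self (χ : Fin n → Fin d) : E χ * E χ = E χ := by simp [E_mul_E]

lemma g_mul_E (i : Fin (n - 1)) (χ : Fin n → Fin d) :
    g i * E χ = E (χ ∘ simpleSwap i) * g i := by
  have h1 (χ : Fin n → Fin d) (ψ : Fin n → Fin d) :
      E ψ * (g i * E χ) = if ψ = χ ∘ simpleSwap i then g i * E χ else 0 := by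
    refine E_mul_of_eigen (fun j => ?_) ψ
    rw [← mul_assoc, ← simpleSwap_simpleSwap i j, ← g_mul_t, mul_assoc, t_mul_E, mul_smul_comm]
    simp
  calc g i * E χ = E (χ ∘ simpleSwap i) * (g i * E χ) := by rw [h1, if_pos rfl]
    _ = ∑ ψ, E (χ ∘ simpleSwap i) * (g i * E ψ) := by
      rw [Finset.sum_eq_single χ _ (by simp)]
      intro ψ _ hψ
      rw [h1, if_neg]
      intro h
      apply hψ
      rw [← comp_simpleSwap_comp_simpleSwap ψ i, ← h, comp_simpleSwap_comp_simpleSwap]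
    _ = E (χ ∘ simpleSwap i) * g i := by rw [← Finset.mul_sum, ← Finset.mul_sum, sum_E, mul_one]

/-- The algebra of functions on the characters, embedded in `Y_{d,n}` by `F ↦ ∑ F(χ) E_χ`. -/
def diag (d n : ℕ) [NeZero d] : ((Fin n → Fin d) → BaseRing) →ₐ[BaseRing] Yokonuma d n :=
  AlgHom.ofLinearMap
    { toFun := fun F => ∑ χ, F χ • E χ
      map_add' := fun F F' => by simp [add_smul, Finset.sum_add_distrib]
      map_smul' := fun r F => by simp [mul_smul, Finset.smul_sum] }
    (by simp [sum_E])
    (fun F F' => by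
      simp [Finset.sum_mul, Finset.mul_sum, E_mul_E, smul_smul, mul_comm])

lemma diag_apply (F : (Fin n → Fin d) → BaseRing) : diag d n F = ∑ χ, F χ • E χ := rfl

lemma algebraMap_eq_diag (r : BaseRing) :
    algebraMap BaseRing (Yokonuma d n) r = diag d n (fun _ => r) :=
  ((diag d n).commutes r).symm

lemma diag_mul_E (F : (Fin n → Fin d) → BaseRing) (χ : Fin n → Fin d) :
    diag d n F * E χ = F χ • E χ := by
  simp [diag_apply, Finset.sum_mul, E_mul_E]

lemma E_mul_diag (F : (Fin n → Fin d) → BaseRing) (χ : Fin n → Fin d) :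
    E χ * diag d n F = F χ • E χ := by
  simp [diag_apply, Finset.mul_sum, E_mul_E]

lemma g_mul_diag (i : Fin (n - 1)) (F : (Fin n → Fin d) → BaseRing) :
    g i * diag d n F = diag d n (fun χ => F (χ ∘ simpleSwap i)) * g i := by
  simp only [diag_apply, Finset.mul_sum, Finset.sum_mul, mul_smul_comm, smul_mul_assoc, g_mul_E]
  refine Fintype.sum_equiv ((simpleSwap i).arrowCongr (Equiv.refl (Fin d))) _ _ fun χ => ?_
  have : (simpleSwap i).arrowCongr (Equiv.refl (Fin d)) χ = χ ∘ simpleSwap i := by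
    ext j
    simp [simpleSwap]
  rw [this, comp_simpleSwap_comp_simpleSwap]

/-- The quadratic relation: `e_i` is the projection onto the words with equal letters in positions
`i` and `i + 1`. -/
lemma g_mul_self' (i : Fin (n - 1)) :
    (g i * g i : Yokonuma d n) = diag d n (fun _ => u ^ 2) +
      diag d n (fun χ => if χ (pos i) = χ (posSucc i) then v else 0) * g i := by
  have hpow (j : Fin n) (χ : Fin n → Fin d) (s : ℕ) : t j ^ s * E χ = root (χ j) ^ s • E χ := by
    induction s with
    | zero => simp
    | succ s ih => rw [pow_succ, mul_assoc, t_mul_E, mul_smul_comm, ih, smul_smul, pow_succ']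
  have h1 : (const (1 / (d : ℂ)) • ∑ s ∈ Finset.range d, t (pos i) ^ s * t (posSucc i) ^ (d - s) :
      Yokonuma d n) = diag d n (fun χ => if χ (pos i) = χ (posSucc i) then 1 else 0) := by
    rw [← mul_one (_ • _), ← sum_E, Finset.mul_sum, diag_apply]
    refine Finset.sum_congr rfl fun χ _ => ?_
    rw [← sum_root_pow, smul_mul_assoc, Finset.sum_mul, mul_smul, Finset.sum_smul]
    congr 1
    refine Finset.sum_congr rfl fun s _ => ?_
    rw [mul_assoc, hpow, mul_smul_comm, hpow, smul_smul, mul_comm]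
  have h2 : v • (fun χ : Fin n → Fin d => if χ (pos i) = χ (posSucc i) then (1 : BaseRing) else 0) =
      fun χ => if χ (pos i) = χ (posSucc i) then v else 0 := by
    ext χ
    simp
  rw [g_mul_self, h1, ← smul_mul_assoc, ← map_smul, algebraMap_eq_diag, h2]

lemma g_mul_g_mul_E {i : Fin (n - 1)} {χ : Fin n → Fin d} (h : χ (pos i) ≠ χ (posSucc i)) :
    g i * (g i * E χ) = (u ^ 2) • E χ := by
  rw [← mul_assoc, g_mul_self', add_mul, diag_mul_E, mul_assoc, g_mul_E, ← mul_assoc, diag_mul_E]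
  simp [h.symm]

end Yokonuma

open Yokonuma

variable {d n : ℕ} [NeZero d]

/-- The function with value `v` on the words with a descent at `i`, and `0` on the others. -/
def descent (i j : Fin n) : (Fin n → Fin d) → BaseRing := fun χ => if χ j < χ i then v else 0

/-- The element `g_i + v f_i`, where `f_i` is the projection onto the words with a descent at `i`.
These elements satisfy the relations of the Hecke algebra. -/
def heckeGen (d : ℕ) {n : ℕ} [NeZero d] (i : Fin (n - 1)) : Yokonuma d n :=
  g i + diag d n (descent (pos i) (posSucc i))

lemma g_mul_descent (i : Fin (n - 1)) (j k : Fin n) :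
    g i * diag d n (descent j k) = diag d n (descent (simpleSwap i j) (simpleSwap i k)) * g i :=
  g_mul_diag i _

lemma heckeGen_mul_self (i : Fin (n - 1)) :
    heckeGen d i * heckeGen d i = algebraMap BaseRing _ (u ^ 2) + v • heckeGen d i := by
  have h1 : descent (posSucc i) (pos i) + descent (pos i) (posSucc i) +
      (fun χ => if χ (pos i) = χ (posSucc i) then v else 0) =
      (fun _ => v : (Fin n → Fin d) → BaseRing) := by
    ext χ
    simp only [descent, Pi.add_apply]
    rcases lt_trichotomy (χ (pos i)) (χ (posSucc i)) with h | h | h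
    · simp [h, h.ne, h.not_gt]
    · simp [h]
    · simp [h, h.ne', h.not_gt]
  have h2 : (descent (pos i) (posSucc i) * descent (pos i) (posSucc i) :
      (Fin n → Fin d) → BaseRing) = v • descent (pos i) (posSucc i) := by
    ext χ
    simp only [descent, Pi.mul_apply, Pi.smul_apply, smul_eq_mul]
    split_ifs <;> simp
  have h3 : v • g i = diag d n (fun _ => v) * g i := by
    rw [Algebra.smul_def, algebraMap_eq_diag]
  rw [heckeGen, add_mul, mul_add, mul_add, ← map_mul, h2, g_mul_descent, smul_add, h3, ← h1,
    algebraMap_eq_diag,    g_mul_self', map_smul, simpleSwap_pos, simpleSwap_posSucc]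
  simp only [map_add, add_mul]
  abel

lemma heckeGen_comm {i j : Fin (n - 1)} (hij : 1 < |(i : ℤ) - (j : ℤ)|) :
    heckeGen d i * heckeGen d j = heckeGen d j * heckeGen d i := by
  have hji : 1 < |(j : ℤ) - (i : ℤ)| := by rwa [abs_sub_comm]
  simp only [heckeGen, add_mul, mul_add, g_mul_descent, simpleSwap_pos_of_far hij,
    simpleSwap_posSucc_of_far hij, simpleSwap_pos_of_far hji, simpleSwap_posSucc_of_far hji,
    g_comm hij, ← map_mul]
  rw [mul_comm (descent (pos j) _)]
  abel

lemma heckeGen_braid {i j : Fin (n - 1)} (hij : (j : ℕ) = i + 1) :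
    heckeGen d i * heckeGen d j * heckeGen d i = heckeGen d j * heckeGen d i * heckeGen d j := by
  have h0 := pos_of_adj hij
  have h1 := simpleSwap_left_posSucc hij
  have h2 := simpleSwap_right_pos hij
  have h3 := simpleSwap_right_posSucc_left hij
  have h4 := simpleSwap_right_posSucc hij
  have h5 := simpleSwap_pos i
  have h6 := simpleSwap_posSucc i
  have expand (x y : Yokonuma d n) (a b : Yokonuma d n) : (x + a) * (y + b) * (x + a) =
      x * y * x + a * y * x + x * b * x + x * (y * a) + a * b * x + a * (y * a) + x * b * a +
        a * b * a := by noncomm_ring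
  have q1 := g_mul_self' (d := d) i
  have q2 := g_mul_self' (d := d) j
  rw [heckeGen, heckeGen, expand, expand, h0]
  rw [h0] at q2
  generalize pos i = p at *
  generalize posSucc i = q at *
  generalize posSucc j = r at *
  -- After moving all functions to the left, the coefficients of `g_i` and of `g_j` on the two sides
  -- agree for every relative order of the three letters involved.
  have c1 : (descent p q * descent q r + descent p r * descent q p +
      descent p r * (fun χ => if χ p = χ q then v else 0) :
      (Fin n → Fin d) → BaseRing) = descent q r * descent p r := by
    ext χ
    simp only [descent, Pi.add_apply, Pi.mul_apply]
    generalize χ p = a, χ q = b, χ r = c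
    split_ifs <;> first | ring1 | (exfalso; order)
  have c2 : (descent q r * descent p q + descent p r * descent r q +
      descent p r * (fun χ => if χ q = χ r then v else 0) :
      (Fin n → Fin d) → BaseRing) = descent p q * descent p r := by
    ext χ
    simp only [descent, Pi.add_apply, Pi.mul_apply]
    generalize χ p = a, χ q = b, χ r = c
    split_ifs <;> first | ring1 | (exfalso; order)
  have c3 : (descent p q * descent q r * descent p q : (Fin n → Fin d) → BaseRing) =
      descent q r * descent p q * descent q r := by
    ext χ
    simp only [descent, Pi.mul_apply]
    split_ifs <;> ring
  have e1 : g i * diag d n (descent q r) = diag d n (descent p r) * g i := by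
    rw [g_mul_descent, h1, h6]
  have e2 : g i * diag d n (descent p q) = diag d n (descent q p) * g i := by
    rw [g_mul_descent, h5, h6]
  have e3 : g j * diag d n (descent p q) = diag d n (descent p r) * g j := by
    rw [g_mul_descent, h2, h3]
  have e4 : g j * diag d n (descent q r) = diag d n (descent r q) * g j := by
    rw [g_mul_descent, h4, h3]
  have e5 : g i * diag d n (descent p r) = diag d n (descent q r) * g i := by
    rw [g_mul_descent, h1, h5]
  have e6 : g j * diag d n (descent p r) = diag d n (descent p q) * g j := by
    rw [g_mul_descent, h2, h4]
  have l1 : g i * (g j * diag d n (descent p q)) = diag d n (descent q r) * (g i * g j) := by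
    rw [e3, ← mul_assoc, e5, mul_assoc]
  have r1 : g j * (g i * diag d n (descent q r)) = diag d n (descent p q) * (g j * g i) := by
    rw [e1, ← mul_assoc, e6, mul_assoc]
  rw [l1, r1, e1, e3]
  have L : g i * g j * g i + diag d n (descent p q) * g j * g i +
      diag d n (descent p r) * g i * g i + diag d n (descent q r) * (g i * g j) +
      diag d n (descent p q) * diag d n (descent q r) * g i +
      diag d n (descent p q) * (diag d n (descent p r) * g j) +
      diag d n (descent p r) * g i * diag d n (descent p q) +
      diag d n (descent p q) * diag d n (descent q r) * diag d n (descent p q) =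
      g i * g j * g i + diag d n (descent p q) * (g j * g i) +
      diag d n (descent q r) * (g i * g j) + diag d n (descent p r) * diag d n (fun _ => u ^ 2) +
      diag d n (descent p q * descent q r * descent p q) +
      diag d n (descent p q * descent q r + descent p r * descent q p +
        descent p r * (fun χ => if χ p = χ q then v else 0)) * g i +
      diag d n (descent p q * descent p r) * g j := by
    simp only [map_add, map_mul, add_mul, mul_assoc, q1, mul_add, e2]
    abel
  have R : g j * g i * g j + diag d n (descent q r) * g i * g j +
      diag d n (descent p r) * g j * g j + diag d n (descent p q) * (g j * g i) +
      diag d n (descent q r) * diag d n (descent p q) * g j +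
      diag d n (descent q r) * (diag d n (descent p r) * g i) +
      diag d n (descent p r) * g j * diag d n (descent q r) +
      diag d n (descent q r) * diag d n (descent p q) * diag d n (descent q r) =
      g j * g i * g j + diag d n (descent q r) * (g i * g j) +
      diag d n (descent p q) * (g j * g i) + diag d n (descent p r) * diag d n (fun _ => u ^ 2) +
      diag d n (descent q r * descent p q * descent q r) +
      diag d n (descent q r * descent p q + descent p r * descent r q +
        descent p r * (fun χ => if χ q = χ r then v else 0)) * g j +
      diag d n (descent q r * descent p r) * g i := by
    simp only [map_add, map_mul, add_mul, mul_assoc, q2, mul_add, e4]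
    abel
  rw [L, R, c1, c2, c3, g_braid hij]
  abel

/-- The embedding `Φ` of the Hecke algebra `H_n` into `Y_{d,n}`. -/
def heckeHom (d n : ℕ) [NeZero d] : Hecke n →ₐ[BaseRing] Yokonuma d n :=
  Hecke.lift (heckeGen d) (fun _ _ => heckeGen_comm) (fun _ _ => heckeGen_braid) heckeGen_mul_self

@[simp] lemma heckeHom_T (i : Fin (n - 1)) : heckeHom d n (Hecke.T i) = heckeGen d i :=
  Hecke.lift_T _ _ _ _ i

lemma E_mul_heckeGen {ψ : Fin n → Fin d} {i : Fin (n - 1)} (hi : i ∈ plateau ψ) :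
    E ψ * heckeGen d i = E ψ * g i := by
  have hi' : ψ (pos i) = ψ (posSucc i) := hi
  rw [heckeGen, mul_add, E_mul_diag]
  simp [descent, hi']

lemma heckeGen_mul_E {ψ : Fin n → Fin d} {i : Fin (n - 1)} (hi : i ∈ plateau ψ) :
    heckeGen d i * E ψ = E ψ * heckeGen d i := by
  have hi' : ψ (pos i) = ψ (posSucc i) := hi
  rw [E_mul_heckeGen hi, heckeGen, add_mul, diag_mul_E, g_mul_E, comp_simpleSwap_of_mem_plateau hi]
  simp [descent, hi']

/-- On the subalgebra generated by the `T_i` for which `ψ` has a plateau at `i`, the map `Φ`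
commutes with the projection `E_ψ`. -/
lemma heckeHom_mul_E {ψ : Fin n → Fin d} {x : Hecke n}
    (hx : x ∈ Algebra.adjoin BaseRing (Hecke.T '' plateau ψ)) :
    heckeHom d n x * E ψ = E ψ * heckeHom d n x := by
  induction hx using Algebra.adjoin_induction with
  | mem x hx =>
    obtain ⟨i, hi, rfl⟩ := hx
    rw [heckeHom_T, heckeGen_mul_E hi]
  | algebraMap r => rw [AlgHom.commutes, Algebra.commutes]
  | add x y _ _ hx hy => rw [map_add, add_mul, mul_add, hx, hy]
  | mul x y _ _ hx hy => rw [map_mul, mul_assoc, hy, ← mul_assoc, hx, mul_assoc]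

end Embedding

/-! ### The representation on functions with values in the Hecke algebra -/

section Representation

attribute [local irreducible] instRingYokonuma instRingHecke instCommRingBaseRing

open Yokonuma

/-- If `a` and `b` satisfy the braid relation and the quadratic relation of the Hecke algebra, then
so do suitable translates by scalars. -/
lemma braid_of_translate {B : Type*} [Ring B] [Algebra BaseRing B] {a b : B} {x y z r : BaseRing}
    (hbr : a * b * a = b * a * b) (ha : a * a = algebraMap BaseRing B r + v • a)
    (hb : b * b = algebraMap BaseRing B r + v • b) (h : x * y + y * z - x * z = v * y) :
    (a - algebraMap BaseRing B x) *
        ((b - algebraMap BaseRing B y) * (a - algebraMap BaseRing B z)) =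
      (b - algebraMap BaseRing B z) *
        ((a - algebraMap BaseRing B y) * (b - algebraMap BaseRing B x)) := by
  rw [mul_assoc, mul_assoc] at hbr
  simp only [Algebra.algebraMap_eq_smul_one] at ha hb ⊢
  simp only [sub_mul, mul_sub, smul_mul_assoc, mul_smul_comm, one_mul, mul_one, hbr, ha, hb]
  rw [← sub_eq_zero]
  calc _ = (x * y + y * z - x * z) • (a - b) - (v * y) • (a - b) := by module
    _ = 0 := by rw [h, sub_self]

variable {d n : ℕ}

/-- The coefficient of the operator by which `g_i` acts on functions with values in `H_n`. -/
def actCoeff (i : Fin (n - 1)) (χ : Fin n → Fin d) : Hecke n :=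
  Hecke.T i - algebraMap BaseRing _ (if χ (pos i) < χ (posSucc i) then v else 0)

/-- The operator by which `g_i` acts on functions with values in `H_n`. It permutes the
characters and multiplies by `T_i` or by `T_i - v = u² T_i⁻¹`. -/
def gAct (d : ℕ) {n : ℕ} (i : Fin (n - 1)) :
    Module.End BaseRing ((Fin n → Fin d) → Hecke n) where
  toFun f χ := actCoeff i χ * f (χ ∘ simpleSwap i)
  map_add' _ _ := funext fun _ => mul_add _ _ _
  map_smul' r _ := funext fun _ => mul_smul_comm r _ _

/-- The operator by which `t_j` acts on functions with values in `H_n`. -/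
def tAct (d : ℕ) {n : ℕ} (j : Fin n) : Module.End BaseRing ((Fin n → Fin d) → Hecke n) where
  toFun f χ := root (χ j) • f χ
  map_add' _ _ := funext fun _ => smul_add _ _ _
  map_smul' r f := funext fun χ => smul_comm (root (χ j)) r (f χ)

lemma gAct_apply (i : Fin (n - 1)) (f : (Fin n → Fin d) → Hecke n) (χ : Fin n → Fin d) :
    gAct d i f χ = actCoeff i χ * f (χ ∘ simpleSwap i) := rfl

lemma tAct_apply (j : Fin n) (f : (Fin n → Fin d) → Hecke n) (χ : Fin n → Fin d) :
    tAct d j f χ = root (χ j) • f χ := rfl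

lemma tAct_pow_apply (j : Fin n) (s : ℕ) (f : (Fin n → Fin d) → Hecke n) (χ : Fin n → Fin d) :
    (tAct d j ^ s) f χ = root (χ j) ^ s • f χ := by
  induction s generalizing f with
  | zero => simp
  | succ s ih => rw [pow_succ, Module.End.mul_apply, ih, tAct_apply, smul_smul, pow_succ]

lemma gAct_comm {i j : Fin (n - 1)} (hij : 1 < |(i : ℤ) - (j : ℤ)|) :
    gAct d i * gAct d j = gAct d j * gAct d i := by
  have hji : 1 < |(j : ℤ) - (i : ℤ)| := by rwa [abs_sub_comm]
  refine LinearMap.ext fun f => funext fun χ => ?_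
  simp only [Module.End.mul_apply, gAct_apply, actCoeff, Function.comp_apply,
    simpleSwap_pos_of_far hij, simpleSwap_posSucc_of_far hij, simpleSwap_pos_of_far hji,
    simpleSwap_posSucc_of_far hji]
  rw [← mul_assoc, ← mul_assoc]
  congr 1
  · simp only [sub_mul, mul_sub, Hecke.T_comm hij, Algebra.commutes, ← map_mul]
    rw [mul_comm (ite _ _ _)]
    abel
  · congr 1
    ext k
    simp [simpleSwap_comm hij]

lemma gAct_braid {i j : Fin (n - 1)} (hij : (j : ℕ) = i + 1) :
    gAct d i * gAct d j * gAct d i = gAct d j * gAct d i * gAct d j := by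
  refine LinearMap.ext fun f => funext fun χ => ?_
  simp only [Module.End.mul_apply, gAct_apply, actCoeff, Function.comp_apply, pos_of_adj hij,
    simpleSwap_left_posSucc hij, simpleSwap_right_pos hij, simpleSwap_right_posSucc_left hij,
    simpleSwap_right_posSucc hij,
    simpleSwap_pos, simpleSwap_posSucc]
  have hf : ((χ ∘ simpleSwap i) ∘ simpleSwap j) ∘ simpleSwap i =
      ((χ ∘ simpleSwap j) ∘ simpleSwap i) ∘ simpleSwap j := by
    ext k
    simp [simpleSwap_braid hij]
  rw [hf]
  simp only [← mul_assoc _ _ (f _)]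
  congr 1
  refine braid_of_translate (Hecke.T_braid hij) (Hecke.T_mul_self i) (Hecke.T_mul_self j) ?_
  generalize χ (pos i) = a, χ (posSucc i) = b, χ (posSucc j) = c
  split_ifs <;> first | ring1 | (exfalso; order)

lemma gAct_mul_self (i : Fin (n - 1)) :
    gAct d i * gAct d i = algebraMap BaseRing _ (u ^ 2) + v • ((const (1 / (d : ℂ)) •
      ∑ s ∈ Finset.range d, tAct d (pos i) ^ s * tAct d (posSucc i) ^ (d - s)) * gAct d i) := by
  refine LinearMap.ext fun f => funext fun χ => ?_
  simp only [Module.End.mul_apply, LinearMap.add_apply, LinearMap.smul_apply, Pi.add_apply,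
    Pi.smul_apply, LinearMap.sum_apply, Finset.sum_apply, tAct_pow_apply, gAct_apply, smul_smul,
    ← Finset.sum_smul, sum_root_pow, Module.algebraMap_end_apply, mul_assoc]
  rw [comp_simpleSwap_comp_simpleSwap, ← mul_assoc]
  have hT := Hecke.T_mul_self i
  rcases lt_trichotomy (χ (pos i)) (χ (posSucc i)) with h | h | h
  · simp only [actCoeff, Function.comp_apply, simpleSwap_pos, simpleSwap_posSucc, h, h.ne,
      h.not_gt, if_true, if_false, map_zero, sub_zero, sub_mul, hT, ← Algebra.smul_def]
    simp [Algebra.smul_def, add_mul]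
  · have hχ : χ ∘ simpleSwap i = χ := comp_simpleSwap_of_mem_plateau h
    simp only [hχ, actCoeff, h, lt_irrefl, if_true, if_false, map_zero, sub_zero, hT, add_mul,
      mul_one, smul_mul_assoc, ← Algebra.smul_def]
  · simp only [actCoeff, Function.comp_apply, simpleSwap_pos, simpleSwap_posSucc, h, h.ne',
      h.not_gt, if_true, if_false, map_zero, sub_zero, mul_sub, hT, ← Algebra.commutes v,
      ← Algebra.smul_def]
    simp [Algebra.smul_def]

/-- The representation of `Y_{d,n}` on the functions from the characters to `H_n`. -/
def rep (d n : ℕ) : Yokonuma d n →ₐ[BaseRing] Module.End BaseRing ((Fin n → Fin d) → Hecke n) :=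
  Yokonuma.lift (gAct d) (tAct d) (fun _ _ => gAct_comm) (fun _ _ => gAct_braid)
    (fun i j => by
      refine LinearMap.ext fun f => funext fun χ => ?_
      simp only [Module.End.mul_apply, tAct_apply]
      exact smul_comm _ _ _)
    (fun i j => by
      refine LinearMap.ext fun f => funext fun χ => ?_
      simp [Module.End.mul_apply, tAct_apply, gAct_apply])
    (fun j => by
      refine LinearMap.ext fun f => funext fun χ => ?_
      simp [tAct_pow_apply, root_pow])
    gAct_mul_self

variable [NeZero d]

lemma rep_E_single (χ ψ : Fin n → Fin d) (h : Hecke n) :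
    rep d n (E χ) (Pi.single ψ h) = if χ = ψ then Pi.single ψ h else 0 := by
  refine E_apply_of_eigen (rep d n) (fun j => ?_) χ
  rw [rep, Yokonuma.lift_t]
  ext χ
  by_cases hχ : χ = ψ
  · subst hχ; simp [tAct_apply]
  · simp [tAct_apply, hχ]

lemma rep_heckeGen_single {ψ : Fin n → Fin d} {i : Fin (n - 1)} (hi : i ∈ plateau ψ)
    (h : Hecke n) : rep d n (heckeGen d i) (Pi.single ψ h) = Pi.single ψ (Hecke.T i * h) := by
  have hi' : ψ (pos i) = ψ (posSucc i) := hi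
  have h1 : rep d n (diag d n (descent (pos i) (posSucc i))) (Pi.single ψ h) = 0 := by
    simp only [diag_apply, map_sum, map_smul, LinearMap.sum_apply, LinearMap.smul_apply,
      rep_E_single]
    rw [Finset.sum_eq_single ψ (fun χ _ hχ => by simp [hχ]) (by simp)]
    simp [descent, hi']
  rw [heckeGen, map_add, LinearMap.add_apply, h1, add_zero, rep, Yokonuma.lift_g]
  ext χ
  rw [gAct_apply]
  by_cases hχ : χ = ψ
  · subst hχ
    simp [comp_simpleSwap_of_mem_plateau hi, actCoeff, hi']
  · have h2 : χ ∘ simpleSwap i ≠ ψ := by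
      intro h3
      apply hχ
      rw [← comp_simpleSwap_comp_simpleSwap χ i, h3, comp_simpleSwap_of_mem_plateau hi]
    simp [hχ, h2]

lemma rep_heckeHom_single {ψ : Fin n → Fin d} {x : Hecke n}
    (hx : x ∈ Algebra.adjoin BaseRing (Hecke.T '' plateau ψ)) (h : Hecke n) :
    rep d n (heckeHom d n x) (Pi.single ψ h) = Pi.single ψ (x * h) := by
  induction hx using Algebra.adjoin_induction generalizing h with
  | mem x hx =>
    obtain ⟨i, hi, rfl⟩ := hx
    rw [heckeHom_T, rep_heckeGen_single hi]
  | algebraMap r =>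
    rw [AlgHom.commutes, AlgHom.commutes, Module.algebraMap_end_apply, ← Algebra.smul_def,
      Pi.single_smul]
  | add x y _ _ hx hy => rw [map_add, map_add, LinearMap.add_apply, hx, hy, add_mul, Pi.single_add]
  | mul x y _ _ hx hy => rw [map_mul, map_mul, Module.End.mul_apply, hy, hx, mul_assoc]

/-- The map `x ↦ Φ(x) E_ψ` is injective on the subalgebra attached to the plateaus of `ψ`: in the
representation on functions, it recovers multiplication by `x`. -/
lemma eq_zero_of_heckeHom_mul_E {ψ : Fin n → Fin d} {x : Hecke n}
    (hx : x ∈ Algebra.adjoin BaseRing (Hecke.T '' plateau ψ)) (h : heckeHom d n x * E ψ = 0) :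
    x = 0 := by
  have h1 := congrArg (fun y => rep d n y (Pi.single ψ 1) ψ) h
  simpa [Module.End.mul_apply, rep_E_single, rep_heckeHom_single hx] using h1

end Representation

/-! ### Words, contents and sorting -/

section Words

variable {d n : ℕ}

lemma comp_simpleSwap_lt {χ : Fin n → Fin d} {i : Fin (n - 1)} (h : χ (posSucc i) < χ (pos i)) :
    toLex (χ ∘ simpleSwap i) < toLex χ :=
  Pi.lex_desc (by simp [pos, posSucc]) h

/-- Bubble sort: every word becomes weakly increasing after finitely many exchanges of adjacent
letters at a descent. -/
lemma sort_induction {P : (Fin n → Fin d) → Prop}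
    (h : ∀ χ, (∀ ψ, toLex ψ < toLex χ → P ψ) → P χ) (χ : Fin n → Fin d) : P χ := by
  have hwf : WellFounded fun a b : Lex (Fin n → Fin d) => a < b := wellFounded_lt
  exact hwf.induction (C := fun a => P (ofLex a)) (toLex χ)
    fun a ih => h (ofLex a) fun ψ hψ => ih (toLex ψ) hψ

lemma monotone_of_no_descent {χ : Fin n → Fin d}
    (h : ¬ ∃ i, χ (posSucc i) < χ (pos i)) : Monotone χ := by
  push Not at h
  cases n with
  | zero => exact fun i => i.elim0
  | succ m => exact Fin.monotone_iff_le_succ.mpr fun i => h i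

lemma no_descent_of_monotone {χ : Fin n → Fin d} (h : Monotone χ) :
    ¬ ∃ i, χ (posSucc i) < χ (pos i) := by
  rintro ⟨i, hi⟩
  exact absurd (h (show pos i ≤ posSucc i by simp [pos, posSucc])) (not_le.mpr hi)

/-- The content of a word: the number of occurrences of each letter. -/
def content (χ : Fin n → Fin d) : Comp d n :=
  ⟨fun a => (Finset.univ.filter fun j => χ j = a).card, by
    rw [← Finset.card_eq_sum_card_fiberwise (s := Finset.univ)
      (fun _ _ => Finset.mem_coe.mpr (Finset.mem_univ _)), Finset.card_univ, Fintype.card_fin]⟩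

lemma content_comp (χ : Fin n → Fin d) (σ : Equiv.Perm (Fin n)) :
    content (χ ∘ σ) = content χ := by
  refine Subtype.ext (funext fun a => ?_)
  change (Finset.univ.filter fun j => χ (σ j) = a).card = (Finset.univ.filter fun j => χ j = a).card
  exact Finset.card_equiv σ (by simp)

/-- In a weakly increasing word, the letters up to `a` fill an initial segment, whose length is a
partial sum of the content. -/
lemma le_iff_lt_sum_content {χ : Fin n → Fin d} (hχ : Monotone χ) (j : Fin n) (a : Fin d) :
    χ j ≤ a ↔ (j : ℕ) < ∑ b ∈ Finset.Iic a, (content χ).1 b := by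
  have h1 : ∑ b ∈ Finset.Iic a, (content χ).1 b =
      (Finset.univ.filter fun j => χ j ≤ a).card := by
    rw [Finset.card_eq_sum_card_fiberwise (t := Finset.Iic a) (f := χ)
      (fun j hj => by simpa using hj)]
    refine Finset.sum_congr rfl fun b hb => ?_
    change (Finset.univ.filter fun j => χ j = b).card = _
    congr 1
    ext j
    have hb' := Finset.mem_Iic.mp hb
    simp only [Finset.mem_filter, Finset.mem_univ, true_and]
    exact ⟨fun h => ⟨h ▸ hb', h⟩, fun h => h.2⟩
  rw [h1]
  constructor
  · intro h
    have h2 : Finset.Iic j ⊆ Finset.univ.filter fun j => χ j ≤ a := fun k hk => by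
      simpa using (hχ (Finset.mem_Iic.mp hk)).trans h
    have h3 := Finset.card_le_card h2
    rw [Fin.card_Iic] at h3
    omega
  · intro h
    by_contra! h'
    have h2 : (Finset.univ.filter fun j => χ j ≤ a) ⊆ Finset.Iio j := fun k hk => by
      simp only [Finset.mem_filter, Finset.mem_univ, true_and] at hk
      rw [Finset.mem_Iio]
      by_contra! hkj
      exact absurd ((hχ hkj).trans hk) (not_le.mpr h')
    have h3 := Finset.card_le_card h2
    rw [Fin.card_Iio] at h3
    omega

lemma eq_of_content_eq {χ ψ : Fin n → Fin d} (hχ : Monotone χ) (hψ : Monotone ψ)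
    (h : content χ = content ψ) : χ = ψ := by
  have key (j : Fin n) (a : Fin d) : χ j ≤ a ↔ ψ j ≤ a := by
    rw [le_iff_lt_sum_content hχ, le_iff_lt_sum_content hψ, h]
  exact funext fun j => le_antisymm ((key j _).mpr le_rfl) ((key j _).mp le_rfl)

lemma I_content {χ : Fin n → Fin d} (hχ : Monotone χ) : (content χ).I = plateau χ := by
  ext i
  constructor
  · intro hi
    by_contra hne
    have hlt : χ (pos i) < χ (posSucc i) :=
      lt_of_le_of_ne (hχ (by simp [pos, posSucc])) hne
    have h1 := (le_iff_lt_sum_content hχ (pos i) (χ (pos i))).mp le_rfl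
    have h2 := (le_iff_lt_sum_content hχ (posSucc i) (χ (pos i))).not.mp (not_le.mpr hlt)
    refine hi (χ (pos i)) ?_
    simp only [pos, posSucc] at h1 h2 ⊢
    omega
  · intro hi a ha
    have hi' : χ (pos i) = χ (posSucc i) := hi
    have h1 : χ (pos i) ≤ a := (le_iff_lt_sum_content hχ _ a).mpr (by rw [ha]; simp [pos])
    have h2 : ¬ χ (posSucc i) ≤ a :=
      (le_iff_lt_sum_content hχ _ a).not.mpr (by rw [ha]; simp [posSucc])
    exact h2 (hi' ▸ h1)

lemma exists_monotone_content (μ : Comp d n) :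
    ∃ χ : Fin n → Fin d, Monotone χ ∧ content χ = μ := by
  let e : (Σ a, Fin (μ.1 a)) ≃ Fin n := finSigmaFinEquiv.trans (finCongr μ.2)
  let χ : Fin n → Fin d := fun j => (e.symm j).1
  refine ⟨χ ∘ Tuple.sort χ, Tuple.monotone_sort χ, ?_⟩
  rw [content_comp]
  refine Subtype.ext (funext fun a => ?_)
  change (Finset.univ.filter fun j => χ j = a).card = μ.1 a
  rw [← Fintype.card_subtype, ← Fintype.card_fin (μ.1 a)]
  refine Fintype.card_congr
    ((e.symm.subtypeEquiv (fun j => Iff.rfl)).trans (Equiv.sigmaSubtype a))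

/-- The weakly increasing word of content `μ`. -/
def sortedWord (μ : Comp d n) : Fin n → Fin d := (exists_monotone_content μ).choose

lemma monotone_sortedWord (μ : Comp d n) : Monotone (sortedWord μ) :=
  (exists_monotone_content μ).choose_spec.1

@[simp] lemma content_sortedWord (μ : Comp d n) : content (sortedWord μ) = μ :=
  (exists_monotone_content μ).choose_spec.2

lemma sortedWord_content {χ : Fin n → Fin d} (hχ : Monotone χ) :
    sortedWord (content χ) = χ :=
  eq_of_content_eq (monotone_sortedWord _) hχ (content_sortedWord _)

lemma heckeSub_eq (μ : Comp d n) :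
    HeckeSub μ = Algebra.adjoin BaseRing (Hecke.T '' plateau (sortedWord μ)) := by
  rw [← I_content (monotone_sortedWord μ), content_sortedWord, HeckeSub]

end Words

/-! ### The corners of the Yokonuma--Hecke algebra -/

section Corners

attribute [local irreducible] instRingYokonuma instRingHecke instCommRingBaseRing

open Yokonuma

variable {d n : ℕ} [NeZero d]

open Classical in
/-- The element `G_χ = u⁻ˡ g_w E_μ` of `E_χ Y E_μ`, where `μ` is the increasing rearrangement of `χ`
and `w` is the shortest permutation carrying `μ` to `χ`; it is defined by bubble sort. -/
def sortElt (χ : Fin n → Fin d) : Yokonuma d n :=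
  if h : ∃ i, χ (posSucc i) < χ (pos i) then
    uinv • (g h.choose * sortElt (χ ∘ simpleSwap h.choose))
  else E χ
termination_by (wellFounded_lt (α := Lex (Fin n → Fin d))).wrap (toLex χ)
decreasing_by exact comp_simpleSwap_lt h.choose_spec

lemma sortElt_of_monotone {χ : Fin n → Fin d} (h : Monotone χ) : sortElt χ = E χ := by
  rw [sortElt, dif_neg (no_descent_of_monotone h)]

/-- The element `sortElt χ` does not depend on the choice of the descents: any two choices can be
completed by the far commutation relation or by the braid relation. -/
lemma sortElt_of_descent (χ : Fin n → Fin d) : ∀ i, χ (posSucc i) < χ (pos i) →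
    sortElt χ = uinv • (g i * sortElt (χ ∘ simpleSwap i)) := by
  induction χ using sort_induction with
  | h χ ih =>
  have far {i j : Fin (n - 1)} (hij : 1 < |(i : ℤ) - (j : ℤ)|) (hi : χ (posSucc i) < χ (pos i))
      (hj : χ (posSucc j) < χ (pos j)) :
      g i * sortElt (χ ∘ simpleSwap i) = g j * sortElt (χ ∘ simpleSwap j) := by
    have hji : 1 < |(j : ℤ) - (i : ℤ)| := by rwa [abs_sub_comm]
    rw [ih _ (comp_simpleSwap_lt hi) j
        (by simpa [simpleSwap_pos_of_far hij, simpleSwap_posSucc_of_far hij] using hj),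
      ih _ (comp_simpleSwap_lt hj) i
        (by simpa [simpleSwap_pos_of_far hji, simpleSwap_posSucc_of_far hji] using hi),
      mul_smul_comm, mul_smul_comm, ← mul_assoc, ← mul_assoc, g_comm hij]
    congr 3
    ext k
    simp [simpleSwap_comm hij]
  have adj {i j : Fin (n - 1)} (hij : (j : ℕ) = i + 1) (hi : χ (posSucc i) < χ (pos i))
      (hj : χ (posSucc j) < χ (pos j)) :
      g i * sortElt (χ ∘ simpleSwap i) = g j * sortElt (χ ∘ simpleSwap j) := by
    have hj' : χ (posSucc j) < χ (posSucc i) := by rwa [pos_of_adj hij] at hj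
    have d1 : (χ ∘ simpleSwap i) (posSucc j) < (χ ∘ simpleSwap i) (pos j) := by
      simpa [simpleSwap_left_posSucc hij, pos_of_adj hij] using hj'.trans hi
    have d2 : ((χ ∘ simpleSwap i) ∘ simpleSwap j) (posSucc i) <
        ((χ ∘ simpleSwap i) ∘ simpleSwap j) (pos i) := by
      simpa [simpleSwap_left_posSucc hij, simpleSwap_right_pos hij,
        simpleSwap_right_posSucc_left hij] using hj'
    have d3 : (χ ∘ simpleSwap j) (posSucc i) < (χ ∘ simpleSwap j) (pos i) := by
      simpa [simpleSwap_right_pos hij,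
        simpleSwap_right_posSucc_left hij] using hj'.trans hi
    have d4 : ((χ ∘ simpleSwap j) ∘ simpleSwap i) (posSucc j) <
        ((χ ∘ simpleSwap j) ∘ simpleSwap i) (pos j) := by
      simpa [simpleSwap_left_posSucc hij, simpleSwap_right_pos hij,
        simpleSwap_right_posSucc hij, pos_of_adj hij] using hi
    have hχ : ((χ ∘ simpleSwap i) ∘ simpleSwap j) ∘ simpleSwap i =
        ((χ ∘ simpleSwap j) ∘ simpleSwap i) ∘ simpleSwap j := by
      ext k
      simp [simpleSwap_braid hij]
    rw [ih _ (comp_simpleSwap_lt hi) j d1,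
      ih _ ((comp_simpleSwap_lt d1).trans (comp_simpleSwap_lt hi)) i d2,
      ih _ (comp_simpleSwap_lt hj) i d3,
      ih _ ((comp_simpleSwap_lt d3).trans (comp_simpleSwap_lt hj)) j d4, hχ]
    simp only [mul_smul_comm]
    rw [← mul_assoc, ← mul_assoc, g_braid hij, mul_assoc, mul_assoc]
  intro j hj
  have hex : ∃ i, χ (posSucc i) < χ (pos i) := ⟨j, hj⟩
  have hi := hex.choose_spec
  rw [sortElt, dif_pos hex]
  congr 1
  generalize hex.choose = i at hi
  rcases eq_or_ne i j with rfl | hne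
  · rfl
  by_cases hij : 1 < |(i : ℤ) - (j : ℤ)|
  · exact far hij hi hj
  · have hne' : (i : ℕ) ≠ j := fun h => hne (Fin.ext h)
    rw [lt_abs] at hij
    rcases (by omega : (j : ℕ) = i + 1 ∨ (i : ℕ) = j + 1) with h | h
    · exact adj h hi hj
    · exact (adj h hj hi).symm

lemma E_mul_sortElt (χ : Fin n → Fin d) : E χ * sortElt χ = sortElt χ := by
  induction χ using sort_induction with
  | h χ ih =>
  by_cases h : ∃ i, χ (posSucc i) < χ (pos i)
  · obtain ⟨i, hi⟩ := h
    have h1 : E χ * g i = g i * E (χ ∘ simpleSwap i) := by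
      rw [g_mul_E, comp_simpleSwap_comp_simpleSwap]
    rw [sortElt_of_descent χ i hi, mul_smul_comm, ← mul_assoc, h1, mul_assoc,
      ih _ (comp_simpleSwap_lt hi)]
  · rw [sortElt_of_monotone (monotone_of_no_descent h), E_mul_self]

lemma t_mul_sortElt (j : Fin n) (χ : Fin n → Fin d) :
    t j * sortElt χ = root (χ j) • sortElt χ := by
  rw [← E_mul_sortElt, ← mul_assoc, t_mul_E, smul_mul_assoc]

lemma g_mul_sortElt_of_ne {χ : Fin n → Fin d} {i : Fin (n - 1)}
    (h : χ (pos i) ≠ χ (posSucc i)) : g i * sortElt χ = u • sortElt (χ ∘ simpleSwap i) := by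
  rcases h.lt_or_gt with h | h
  · rw [sortElt_of_descent (χ ∘ simpleSwap i) i (by simpa using h),
      comp_simpleSwap_comp_simpleSwap, smul_smul, u_mul_uinv, one_smul]
  · rw [sortElt_of_descent χ i h, ← E_mul_sortElt (χ ∘ simpleSwap i), mul_smul_comm, ← mul_assoc,
      ← mul_assoc, mul_assoc (g i), g_mul_g_mul_E (by simpa using h.ne), smul_mul_assoc, smul_smul,
      E_mul_sortElt, pow_two, ← mul_assoc, uinv_mul_u, one_mul]

/-- If `w` is the shortest permutation carrying the sorted word to `χ` and `χ` has equal letters in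
positions `i` and `i + 1`, then `s_i w = w s_p` for some `p`, and accordingly `g_i` moves past
`sortElt χ`. -/
lemma g_mul_sortElt_of_eq (χ : Fin n → Fin d) : ∀ i, χ (pos i) = χ (posSucc i) →
    ∃ p ∈ (content χ).I, g i * sortElt χ = sortElt χ * heckeGen d p := by
  induction χ using sort_induction with
  | h χ ih =>
  intro i hi
  by_cases h : ∃ j, χ (posSucc j) < χ (pos j)
  · obtain ⟨j, hj⟩ := h
    have hne : i ≠ j := by
      rintro rfl
      exact hj.ne hi.symm
    by_cases hij : 1 < |(i : ℤ) - (j : ℤ)|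
    · have hji : 1 < |(j : ℤ) - (i : ℤ)| := by rwa [abs_sub_comm]
      obtain ⟨p, hp, hgp⟩ := ih _ (comp_simpleSwap_lt hj) i
        (by simpa [simpleSwap_pos_of_far hji, simpleSwap_posSucc_of_far hji] using hi)
      refine ⟨p, content_comp χ _ ▸ hp, ?_⟩
      rw [sortElt_of_descent χ j hj, mul_smul_comm, ← mul_assoc, g_comm hij, mul_assoc, hgp,
        smul_mul_assoc, mul_assoc]
    have hne' : (i : ℕ) ≠ j := fun h => hne (Fin.ext h)
    rw [lt_abs] at hij
    rcases (by omega : (j : ℕ) = i + 1 ∨ (i : ℕ) = j + 1) with hij | hij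
    · -- The letters in positions `i, i + 1, i + 2` are `a, a, b` with `b < a`.
      rw [pos_of_adj hij] at hj
      have d1 : χ (posSucc j) < χ (pos j) := by rwa [pos_of_adj hij]
      have d2 : (χ ∘ simpleSwap j) (posSucc i) < (χ ∘ simpleSwap j) (pos i) := by
        simpa [simpleSwap_right_pos hij, simpleSwap_right_posSucc_left hij, hi] using hj
      obtain ⟨p, hp, hgp⟩ := ih _ ((comp_simpleSwap_lt d2).trans (comp_simpleSwap_lt d1)) j
        (by simpa [simpleSwap_left_posSucc hij, simpleSwap_right_pos hij,
        simpleSwap_right_posSucc hij, pos_of_adj hij]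
          using hi)
      rw [content_comp, content_comp] at hp
      refine ⟨p, hp, ?_⟩
      rw [sortElt_of_descent χ j d1, sortElt_of_descent _ i d2]
      simp only [mul_smul_comm, smul_mul_assoc]
      rw [← mul_assoc, ← mul_assoc, g_braid hij, mul_assoc, hgp, mul_assoc, mul_assoc, mul_assoc]
    · -- The letters in positions `j, j + 1, j + 2` are `a, b, b` with `b < a`.
      rw [pos_of_adj hij] at hi
      have d2 : (χ ∘ simpleSwap j) (posSucc i) < (χ ∘ simpleSwap j) (pos i) := by
        simpa [simpleSwap_left_posSucc hij, pos_of_adj hij, hi] using hi ▸ hj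
      obtain ⟨p, hp, hgp⟩ := ih _ ((comp_simpleSwap_lt d2).trans (comp_simpleSwap_lt hj)) j
        (by simpa [simpleSwap_left_posSucc hij, simpleSwap_right_pos hij,
          simpleSwap_right_posSucc_left hij, pos_of_adj hij]
          using hi)
      rw [content_comp, content_comp] at hp
      refine ⟨p, hp, ?_⟩
      rw [sortElt_of_descent χ j hj, sortElt_of_descent _ i d2]
      simp only [mul_smul_comm, smul_mul_assoc]
      rw [← mul_assoc, ← mul_assoc, ← g_braid hij, mul_assoc, hgp, mul_assoc, mul_assoc, mul_assoc]
  · have hm := monotone_of_no_descent h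
    refine ⟨i, I_content hm ▸ hi, ?_⟩
    rw [sortElt_of_monotone hm, E_mul_heckeGen hi, g_mul_E, comp_simpleSwap_of_mem_plateau hi]

/-- The span of the elements `G_χ Φ(x)`, where `χ` has content `ν` and `x` lies in `H^ν`. -/
def sortSpan (ν : Comp d n) : Submodule BaseRing (Yokonuma d n) :=
  Submodule.span BaseRing
    {y | ∃ χ, content χ = ν ∧ ∃ x ∈ HeckeSub ν, y = sortElt χ * heckeHom d n x}

/-- The left ideal `Y E_ν` lies in `sortSpan ν`: the span contains `E_ν`, and it is stable under
left multiplication by the generators. -/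
lemma mul_E_mem_sortSpan (ν : Comp d n) (y : Yokonuma d n) :
    y * E (sortedWord ν) ∈ sortSpan ν := by
  refine mul_mem_of_generators (fun i z hz => ?_) (fun j z hz => ?_) y (Submodule.subset_span
    ⟨sortedWord ν, content_sortedWord ν, 1, one_mem _, by
      rw [map_one, mul_one, sortElt_of_monotone (monotone_sortedWord ν)]⟩)
  · induction hz using Submodule.span_induction with
    | mem z hz =>
      obtain ⟨χ, rfl, x, hx, rfl⟩ := hz
      rw [← mul_assoc]
      by_cases hi : χ (pos i) = χ (posSucc i)
      · obtain ⟨p, hp, hgp⟩ := g_mul_sortElt_of_eq χ i hi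
        rw [hgp, mul_assoc, ← heckeHom_T, ← map_mul]
        exact Submodule.subset_span
          ⟨χ, rfl, _, mul_mem (Algebra.subset_adjoin ⟨p, hp, rfl⟩) hx, rfl⟩
      · rw [g_mul_sortElt_of_ne hi, smul_mul_assoc]
        exact Submodule.smul_mem _ _ (Submodule.subset_span ⟨_, content_comp χ _, x, hx, rfl⟩)
    | zero => rw [mul_zero]; exact zero_mem _
    | add z z' _ _ h h' => rw [mul_add]; exact add_mem h h'
    | smul r z _ h => rw [mul_smul_comm]; exact Submodule.smul_mem _ _ h
  · induction hz using Submodule.span_induction with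
    | mem z hz =>
      obtain ⟨χ, rfl, x, hx, rfl⟩ := hz
      rw [← mul_assoc, t_mul_sortElt, smul_mul_assoc]
      exact Submodule.smul_mem _ _ (Submodule.subset_span ⟨χ, rfl, x, hx, rfl⟩)
    | zero => rw [mul_zero]; exact zero_mem _
    | add z z' _ _ h h' => rw [mul_add]; exact add_mem h h'
    | smul r z _ h => rw [mul_smul_comm]; exact Submodule.smul_mem _ _ h

lemma E_mul_sortElt_of_ne {χ ψ : Fin n → Fin d} (h : ψ ≠ χ) : E ψ * sortElt χ = 0 := by
  rw [← E_mul_sortElt, ← mul_assoc, E_mul_E, if_neg h, zero_mul]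

lemma E_mul_mul_E_of_ne {μ ν : Comp d n} (h : μ ≠ ν) (y : Yokonuma d n) :
    E (sortedWord μ) * y * E (sortedWord ν) = 0 := by
  rw [mul_assoc]
  have hz := mul_E_mem_sortSpan ν y
  generalize y * E (sortedWord ν) = z at hz ⊢
  induction hz using Submodule.span_induction with
  | mem z hz =>
    obtain ⟨χ, rfl, x, hx, rfl⟩ := hz
    rw [← mul_assoc, E_mul_sortElt_of_ne, zero_mul]
    rintro rfl
    exact h (content_sortedWord μ).symm
  | zero => rw [mul_zero]
  | add z z' _ _ h h' => rw [mul_add, h, h', add_zero]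
  | smul r z _ h => rw [mul_smul_comm, h, smul_zero]

/-- Every element of the corner `E_μ Y E_μ` comes from `H^μ`. -/
lemma exists_heckeHom_eq (μ : Comp d n) (y : Yokonuma d n) : ∃ x ∈ HeckeSub μ,
    heckeHom d n x * E (sortedWord μ) = E (sortedWord μ) * y * E (sortedWord μ) := by
  rw [mul_assoc]
  have hz := mul_E_mem_sortSpan μ y
  generalize y * E (sortedWord μ) = z at hz ⊢
  have comm {x : Hecke n} (hx : x ∈ HeckeSub μ) :
      heckeHom d n x * E (sortedWord μ) = E (sortedWord μ) * heckeHom d n x :=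
    heckeHom_mul_E ((heckeSub_eq μ).le hx)
  induction hz using Submodule.span_induction with
  | mem z hz =>
    obtain ⟨χ, hχ, x, hx, rfl⟩ := hz
    by_cases h : sortedWord μ = χ
    · subst h
      refine ⟨x, hx, ?_⟩
      rw [comm hx, ← mul_assoc, sortElt_of_monotone (monotone_sortedWord μ), E_mul_self]
    · exact ⟨0, zero_mem _, by
        rw [map_zero, zero_mul, ← mul_assoc, E_mul_sortElt_of_ne h, zero_mul]⟩
  | zero => exact ⟨0, zero_mem _, by rw [map_zero, zero_mul, mul_zero]⟩
  | add z z' _ _ h h' =>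
    obtain ⟨x, hx, e⟩ := h
    obtain ⟨x', hx', e'⟩ := h'
    exact ⟨x + x', add_mem hx hx', by rw [map_add, add_mul, mul_add, e, e']⟩
  | smul r z _ h =>
    obtain ⟨x, hx, e⟩ := h
    exact ⟨r • x, Subalgebra.smul_mem _ hx r, by
      rw [map_smul, smul_mul_assoc, mul_smul_comm, e]⟩

/-- Each `E_χ` lies in the two-sided ideal generated by the idempotent of the sorted word. -/
lemma exists_E_eq_mul (χ : Fin n → Fin d) :
    ∃ a b : Yokonuma d n, a * E (sortedWord (content χ)) * b = E χ := by
  induction χ using sort_induction with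
  | h χ ih =>
  by_cases h : ∃ i, χ (posSucc i) < χ (pos i)
  · obtain ⟨i, hi⟩ := h
    obtain ⟨a, b, hab⟩ := ih _ (comp_simpleSwap_lt hi)
    rw [content_comp] at hab
    refine ⟨uinv ^ 2 • (g i * a), b * g i, ?_⟩
    calc (uinv ^ 2 • (g i * a)) * E (sortedWord (content χ)) * (b * g i) =
        uinv ^ 2 • (g i * (a * E (sortedWord (content χ)) * b * g i)) := by
          simp only [smul_mul_assoc, mul_assoc]
      _ = uinv ^ 2 • u ^ 2 • E χ := by
          rw [hab, ← g_mul_E, g_mul_g_mul_E hi.ne']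
      _ = E χ := by rw [smul_smul, ← mul_pow, uinv_mul_u, one_pow, one_smul]
  · exact ⟨1, 1, by rw [sortedWord_content (monotone_of_no_descent h), one_mul, mul_one]⟩

/-- The map `H^μ → Y_{d,n}`, `x ↦ Φ(x) E_μ`. -/
def cornerMap (μ : Comp d n) : HeckeSub μ →ₗ[BaseRing] Yokonuma d n :=
  LinearMap.mulRight BaseRing (E (sortedWord μ)) ∘ₗ (heckeHom d n).toLinearMap ∘ₗ
    (HeckeSub μ).val.toLinearMap

lemma cornerMap_apply (μ : Comp d n) (x : HeckeSub μ) :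
    cornerMap μ x = heckeHom d n (x : Hecke n) * E (sortedWord μ) := rfl

lemma cornerMap_one (μ : Comp d n) : cornerMap μ 1 = E (sortedWord μ) := by
  rw [cornerMap_apply, OneMemClass.coe_one, map_one, one_mul]

lemma cornerMap_injective (μ : Comp d n) : Function.Injective (cornerMap μ) := by
  rw [injective_iff_map_eq_zero]
  intro x hx
  exact Subtype.ext (eq_zero_of_heckeHom_mul_E ((heckeSub_eq μ).le x.2) hx)

lemma cornerMap_mul (μ : Comp d n) (x y : HeckeSub μ) :
    cornerMap μ (x * y) = cornerMap μ x * cornerMap μ y := by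
  have hy := heckeHom_mul_E ((heckeSub_eq μ).le y.2)
  simp only [cornerMap_apply, MulMemClass.coe_mul, map_mul]
  rw [mul_assoc, mul_assoc, hy, ← mul_assoc (E _) (E _), E_mul_self]

lemma mem_range_cornerMap (μ : Comp d n) (y : Yokonuma d n) :
    LinearMap.mulLeftRight BaseRing (E (sortedWord μ), E (sortedWord μ)) y ∈
      LinearMap.range (cornerMap μ) := by
  obtain ⟨x, hx, h⟩ := exists_heckeHom_eq μ y
  exact ⟨⟨x, hx⟩, h⟩

/-- The algebras `H^μ` are the corners of `Y_{d,n}` at the idempotents of the sorted words. -/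
def cornerSystem (d n : ℕ) [NeZero d] :
    CornerSystem BaseRing (Yokonuma d n) (fun μ : Comp d n => HeckeSub μ) where
  φ := cornerMap
  ρ μ := (LinearEquiv.ofInjective (cornerMap μ) (cornerMap_injective μ)).symm.toLinearMap ∘ₗ
    LinearMap.codRestrict _ _ (mem_range_cornerMap μ)
  φ_mul := cornerMap_mul
  φ_ρ μ y := by
    rw [cornerMap_one]
    exact congrArg Subtype.val
      (LinearEquiv.apply_symm_apply (LinearEquiv.ofInjective (cornerMap μ) (cornerMap_injective μ))
        ⟨_, mem_range_cornerMap μ y⟩)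
  ρ_φ μ x := by
    rw [LinearMap.comp_apply, LinearEquiv.coe_coe, LinearEquiv.symm_apply_eq]
    refine Subtype.ext ?_
    change E (sortedWord μ) * cornerMap μ x * E (sortedWord μ) = cornerMap μ x
    rw [← cornerMap_one, ← cornerMap_mul, ← cornerMap_mul, one_mul, mul_one]
  orth μ ν h y := by
    rw [cornerMap_one, cornerMap_one]
    exact E_mul_mul_E_of_ne h y
  full := by
    choose a b hab using exists_E_eq_mul (d := d) (n := n)
    refine ⟨Fin n → Fin d, inferInstance, content, a, b, ?_⟩
    simp only [cornerMap_one, hab, sum_E]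

end Corners

end

end YokonumaHecke

/-- The direct sum of the algebras `R_θ H^μ` over the finite set `Comp_d(n)` is their product, with
componentwise operations. -/
theorem proposition4p2 (d n : ℕ) (hd : 1 ≤ d) {R : Type*} [CommRing R]
    (θ : YokonumaHecke.BaseRing →+* R) :
    IsMoritaEquivalent R
      (YokonumaHecke.Specialized θ (YokonumaHecke.Yokonuma d n))
      ((μ : YokonumaHecke.Comp d n) →
        YokonumaHecke.Specialized θ (YokonumaHecke.HeckeSub μ)) := by
  have : NeZero d := ⟨by omega⟩
  exact (YokonumaHecke.cornerSystem d n).isMoritaEquivalent_specialized θ
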